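/- **Setting.** Let $X$ be a surface homeomorphic to the plane, $\pi:X\to\overline{\mathbf C}$ a local homeomorphism, and $A\subset\overline{\mathbf C}$ a finite set, invariant under complex conjugation (its elements are called base points), such that $\pi:X\setminus\pi^{-1}(A)\to\overline{\mathbf C}\setminus A$ is a covering. Fix pairwise disjoint open round discs $D_a$ centered at the points $a\in A$. A component $V$ of $\pi^{-1}(D_a\setminus\{a\})$ on which $\pi$ has infinite degree is called a logarithmic singularity over $a$; suppose that there are only finitely many of them. Let $s:X\to X$ be a homeomorphism with $s\circ s=\mathrm{id}$ and $\pi(s(x))=\overline{\pi(x)}$. Then $(X,\pi,s)$ is a symmetric N-surface; its axis is the set of fixed points of $s$. A logarithmic singularity $V$ over a real base point $a\in\mathbf R\cup\{\infty\}$ is called real if $s(V)=V$. An associated real Nevanlinna function is a real meromorphic function $f=\pi\circ\phi$ in $\mathbf C$, where $\phi:\mathbf C\to X$ is a homeomorphism such that $\pi\circ\phi$ is meromorphic and $\phi(\overline z)=s(\phi(z))$. **Symmetric Speiser graph.** If more than two base points are real, choose two real base points such that all real logarithmic singularities lie over these two points, and let $M$ be the set of all other real base points; if at most two base points are real, let $M=\emptyset$.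 For $a\in M$ choose $\varepsilon_a>0$ with $a+i\varepsilon_a\in D_a$ (for $a=\infty$ this point is read in the chart $-1/z$) and a homeomorphism $\eta_a$ of $\overline{\mathbf C}$ which is the identity outside $D_a$ and sends $a$ to $a+i\varepsilon_a$. Let $H$ be one of the two components of the complement of the axis. Define $\pi^*$ by $\pi^*(x)=\eta_a(\pi(x))$ if $x$ belongs to a logarithmic singularity $V\subset H$ over some $a\in M$, by $\pi^*(x)=\overline{\eta_a(\overline{\pi(x)})}$ if $x$ belongs to a logarithmic singularity $V\subset s(H)$ over some $a\in M$, and by $\pi^*(x)=\pi(x)$ otherwise. The new base points are the points of $A\setminus M$ and the points $a\pm i\varepsilon_a$, $a\in M$; the latter stand for labels $a^{\pm}$. Let $\Gamma\subset\overline{\mathbf C}$ be a Jordan curve through the new base points, symmetric with respect to complex conjugation. Choose points $\times,\circ\in\mathbf R\cup\{\infty\}$ in different components of $\overline{\mathbf C}\setminus\Gamma$, and simple arcs from $\times$ to $\circ$, disjoint except for their endpoints, exactly one for each open arc of $\Gamma$ between consecutive new base points, so that each of these simple arcs meets $\Gamma$ in exactly one point, which belongs to the corresponding arc of $\Gamma$,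 and so that the union $L$ of the simple arcs is symmetric. Then $S=(\pi^*)^{-1}(L)$ is a symmetric Speiser graph of $(X,\pi,s)$. Its vertices are the preimages of $\times$ and $\circ$, its edges are the components of the preimage of $L\setminus\{\times,\circ\}$, and its faces are the components of $X\setminus S$. A face is labeled by the new base point $b$ if $\pi^*$ maps it to the component of $\overline{\mathbf C}\setminus L$ that contains $b$. A face is bounded if its boundary consists of finitely many edges and vertices, and otherwise unbounded. Let $T(S)$ be the graph obtained from $S$ by replacing multiple edges by single ones; logarithmic ends of $S$ are the maximal (by inclusion) infinite one-sided branches of $T(S)$ all of whose vertices have degree $2$ in $T(S)$. **Proposition 3.** Let $S$ be a symmetric Speiser graph of a symmetric N-surface $(X,\pi,s)$, and let $f$ be an associated real Nevanlinna function. Assume that the number of logarithmic ends is at least $3$, that $0$ is a base point, that there is at most one real logarithmic singularity which does not lie over $0$, and that $S$ does not have labels $0^+$ or $0^-$ (that is, $0\notin M$). Then all zeros of $f$ are real if and only if each vertex of $S$ belongs either to the axis or to the boundary of an unbounded face labeled by $0$. -/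

import Mathlib

open scoped OnePoint

noncomputable section

namespace NSurface

/-! ### The Riemann sphere -/

/-- The Riemann sphere. -/
abbrev Sphere : Type := OnePoint ℂ

/-- Complex conjugation on the Riemann sphere (it fixes `∞`). -/
def conj : Sphere → Sphere := OnePoint.map (starRingEnd ℂ)

/-- The open round disc of radius `r` about `a`; for `a = ∞` it is `{|z| > 1/r} ∪ {∞}`. -/
def disc (a : Sphere) (r : ℝ) : Set Sphere :=
  a.elim ((fun z : ℂ => (z : Sphere)) '' Metric.closedBall 0 r⁻¹)ᶜ
    (fun z => (fun w : ℂ => (w : Sphere)) '' Metric.ball z r)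

/-- The point `a + iε`; at `a = ∞` this is read in the chart `w = -1/z`, which preserves the upper
half-plane, so that it is the point `i/ε`. -/
def shift (a : Sphere) (ε : ℝ) : Sphere :=
  a.elim ((Complex.I / (ε : ℂ) : ℂ) : Sphere) (fun z => ((z + (ε : ℂ) * Complex.I : ℂ) : Sphere))

/-- `C` is a connected component of the subset `T`. -/
def IsComponentOf {Y : Type*} [TopologicalSpace Y] (T C : Set Y) : Prop :=
  ∃ x ∈ T, C = connectedComponentIn T x

/-! ### Logarithmic singularities and N-surfaces -/

section Surfaces

variable {X : Type*} [TopologicalSpace X]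

/-- `V` defines a logarithmic singularity over `a`, as seen in the disc of radius `r` about `a`:
`V` is a component of the preimage of the punctured disc, of infinite degree over it. -/
def IsLogSingularity (π : X → Sphere) (a : Sphere) (r : ℝ) (V : Set X) : Prop :=
  IsComponentOf (π ⁻¹' (disc a r \ {a})) V ∧
    ∃ y ∈ disc a r \ {a}, (V ∩ π ⁻¹' {y}).Infinite

/-- `(X, π)` is an N-surface with set of base points `A`. -/
structure IsNSurface (A : Set Sphere) (π : X → Sphere) : Prop where
  /-- `X` is an open simply connected surface, that is, homeomorphic to the plane. -/
  plane : Nonempty (X ≃ₜ ℂ)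
  isLocalHomeomorph : IsLocalHomeomorph π
  finite_base : A.Finite
  isCoveringMapOn : IsCoveringMapOn π Aᶜ
  finite_log : ∀ a ∈ A, ∀ r > 0, disc a r ∩ A = {a} → {V | IsLogSingularity π a r V}.Finite

/-- `(X, π, s)` is a symmetric N-surface with (conjugation invariant) set of base points `A`. -/
structure IsSymmetricNSurface (A : Set Sphere) (π : X → Sphere) (s : X → X) : Prop
    extends IsNSurface A π where
  continuous_inv : Continuous s
  involutive : Function.Involutive s
  map_inv : ∀ x, π (s x) = conj (π x)
  conj_base : ∀ a ∈ A, conj a ∈ A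

/-- The axis of symmetry. -/
def axis (s : X → X) : Set X := {x | s x = x}

/-- The real base points. -/
def realBase (A : Set Sphere) : Set Sphere := {a ∈ A | conj a = a}

/-- A choice of disjoint round discs about the base points; in particular each of them contains
exactly one base point. -/
structure DiscSystem (A : Set Sphere) where
  radius : Sphere → ℝ
  radius_pos : ∀ a ∈ A, 0 < radius a
  disjoint : A.PairwiseDisjoint fun a => disc a (radius a)

/-- The real logarithmic singularities, as pairs of a real base point `a` and a region `V` over
the disc about `a` with `s(V) = V`. -/
def realLogSingularities {A : Set Sphere} (π : X → Sphere) (s : X → X) (D : DiscSystem A) :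
    Set (Sphere × Set X) :=
  {p | p.1 ∈ realBase A ∧ IsLogSingularity π p.1 (D.radius p.1) p.2 ∧ s '' p.2 = p.2}

end Surfaces

/-! ### Moving real base points off the real line -/

/-- The symmetric deformation of a symmetric N-surface that replaces real base points `a`, over
which there are no real logarithmic singularities, by pairs `a ± iε` of nonreal base points. All
real base points but two are moved (none, if there are at most two). -/
structure Deformation {X : Type*} [TopologicalSpace X] {A : Set Sphere} (π : X → Sphere)
    (s : X → X) (D : DiscSystem A) where
  /-- The set of the real base points that are moved. -/
  moved : Set Sphere
  moved_subset : moved ⊆ realBase A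
  ncard_kept : (realBase A \ moved).ncard = min 2 (realBase A).ncard
  not_real : ∀ p ∈ realLogSingularities π s D, p.1 ∉ moved
  /-- One of the two halfplanes into which the axis divides the surface. -/
  half : Set X
  half_spec : IsComponentOf (axis s)ᶜ half
  ε : Sphere → ℝ
  ε_pos : ∀ a ∈ moved, 0 < ε a
  shift_mem : ∀ a ∈ moved, shift a (ε a) ∈ disc a (D.radius a)
  /-- The homeomorphism that moves `a` to `a + iε` and is the identity outside the disc. -/
  η : Sphere → Sphere ≃ₜ Sphere
  η_off : ∀ a ∈ moved, ∀ y ∉ disc a (D.radius a), η a y = y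
  η_base : ∀ a ∈ moved, η a a = shift a (ε a)
  /-- The deformed map. -/
  map : X → Sphere
  map_plus : ∀ a ∈ moved, ∀ V, IsLogSingularity π a (D.radius a) V → V ⊆ half →
    ∀ x ∈ V, map x = η a (π x)
  map_minus : ∀ a ∈ moved, ∀ V, IsLogSingularity π a (D.radius a) V → V ⊆ s '' half →
    ∀ x ∈ V, map x = conj (η a (conj (π x)))
  map_otherwise : ∀ x, (∀ a ∈ moved, ∀ V, IsLogSingularity π a (D.radius a) V → x ∉ V) →
    map x = π x

/-- The base points of the deformed surface: an unmoved `a` is its own label, and the points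
`a + iε` and `a - iε` stand for the labels `a⁺` and `a⁻` of a moved point `a`. -/
def Deformation.base {X : Type*} [TopologicalSpace X] {A : Set Sphere} {π : X → Sphere}
    {s : X → X} {D : DiscSystem A} (E : Deformation π s D) : Set Sphere :=
  (A \ E.moved) ∪ {b | ∃ a ∈ E.moved, b = shift a (E.ε a) ∨ b = conj (shift a (E.ε a))}

/-! ### The graph on the sphere -/

/-- The unit vector of angle `θ`, as a point of the sphere. -/
def unitPt (θ : ℝ) : Sphere := ((Complex.exp ((θ : ℂ) * Complex.I) : ℂ) : Sphere)

/-- The open ray of angle `θ` from `0` to `∞`. -/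
def openRay (θ : ℝ) : Set Sphere :=
  {y | ∃ t : ℝ, 0 < t ∧ y = (((t : ℂ) * Complex.exp ((θ : ℂ) * Complex.I) : ℂ) : Sphere)}

/-- A symmetric base curve through the points of `B`, together with a symmetric graph `L` that has
two vertices `×` and `∘`, on the real circle and on different sides of the curve, and disjoint
simple arcs `L_j` between them, one for each pair of consecutive points of `B`, such that `L_j`
crosses the curve at exactly one point, which lies between these two points.

By the Schoenflies theorem every such configuration is the image of a standard one under a
homeomorphism `h` of the sphere that commutes with complex conjugation; in the standard one, the
curve is the unit circle, `×` is `0`, `∘` is `∞`, and the arcs are the radial rays. -/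
structure SymmetricBaseGraph (B : Set Sphere) where
  h : Sphere ≃ₜ Sphere
  h_conj : ∀ y, h (conj y) = conj (h y)
  /-- The number of base points. -/
  q : ℕ
  /-- The angles of the base points, in their cyclic order. -/
  α : Fin (q + 1) → ℝ
  α_strictMono : StrictMono α
  α_last : α (Fin.last q) = α 0 + 2 * Real.pi
  /-- The angles of the arcs. -/
  β : Fin q → ℝ
  β_mem : ∀ j, β j ∈ Set.Ioo (α j.castSucc) (α j.succ)
  base_eq : Set.range (fun j : Fin q => h (unitPt (α j.castSucc))) = B
  /-- The union of the arcs is symmetric. -/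
  symm : conj '' (⋃ j, h '' openRay (β j)) = ⋃ j, h '' openRay (β j)

namespace SymmetricBaseGraph

variable {B : Set Sphere} (G : SymmetricBaseGraph B)

/-- The base curve. -/
def curve : Set Sphere := Set.range fun θ : ℝ => G.h (unitPt θ)

/-- The vertex `×`. -/
def cross : Sphere := G.h ((0 : ℂ) : Sphere)

/-- The vertex `∘`. -/
def circ : Sphere := G.h ∞

/-- The union of the open edges. -/
def openEdges : Set Sphere := ⋃ j, G.h '' openRay (G.β j)

/-- The embedded graph `L`. -/
def graph : Set Sphere := {G.cross, G.circ} ∪ G.openEdges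

end SymmetricBaseGraph

/-! ### Symmetric Speiser graphs -/

/-- A symmetric Speiser graph of the symmetric N-surface `(X, π, s)`: it is the preimage of a
symmetric graph on the sphere under a symmetric deformation of `π`. -/
structure SymmetricSpeiserGraph {X : Type*} [TopologicalSpace X] {A : Set Sphere} (π : X → Sphere)
    (s : X → X) (D : DiscSystem A) where
  deformation : Deformation π s D
  baseGraph : SymmetricBaseGraph deformation.base

namespace SymmetricSpeiserGraph

variable {X : Type*} [TopologicalSpace X] {A : Set Sphere} {π : X → Sphere} {s : X → X}
  {D : DiscSystem A} (S : SymmetricSpeiserGraph π s D)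

/-- The Speiser graph as a subset of the surface. -/
def carrier : Set X := S.deformation.map ⁻¹' S.baseGraph.graph

/-- The vertices. -/
def vertices : Set X := S.deformation.map ⁻¹' {S.baseGraph.cross, S.baseGraph.circ}

/-- `e` is an (open) edge. -/
def IsEdge (e : Set X) : Prop := IsComponentOf (S.deformation.map ⁻¹' S.baseGraph.openEdges) e

/-- `F` is a face. -/
def IsFace (F : Set X) : Prop := IsComponentOf S.carrierᶜ F

/-- The face `F` is bounded: its boundary consists of finitely many edges and vertices. -/
def IsBounded (F : Set X) : Prop :=
  {e | S.IsEdge e ∧ e ⊆ frontier F}.Finite ∧ (S.vertices ∩ frontier F).Finite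

/-- The set `F` (a face) is labeled by `b`: it lies over the face of the graph on the sphere that
contains `b`. -/
def HasLabel (F : Set X) (b : Sphere) : Prop :=
  b ∈ S.deformation.base ∧
    S.deformation.map '' F ⊆ connectedComponentIn S.baseGraph.graphᶜ b

/-- The tree `T(S)`: vertices are joined by a single edge if they are joined by at least one edge
of the Speiser graph. -/
def tree : SimpleGraph S.vertices where
  Adj v w := v ≠ w ∧ ∃ e, S.IsEdge e ∧ (v : X) ∈ closure e ∧ (w : X) ∈ closure e
  symm := ⟨fun _ _ h => ⟨h.1.symm, h.2.imp fun _ he => ⟨he.1, he.2.2, he.2.1⟩⟩⟩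
  loopless := ⟨fun _ h => h.1 rfl⟩

/-- The (vertex set of an) infinite branch of the tree, all of whose vertices have degree two. -/
def IsBranch (b : Set S.vertices) : Prop :=
  ∃ u : ℕ → S.vertices, Function.Injective u ∧ (∀ n, S.tree.Adj (u n) (u (n + 1))) ∧
    (∀ n, (S.tree.neighborSet (u n)).ncard = 2) ∧ b = Set.range u

/-- The logarithmic ends: the maximal branches. -/
def logEnds : Set (Set S.vertices) := {b | Maximal S.IsBranch b}

end SymmetricSpeiserGraph

/-! ### The associated function -/

/-- The map to the sphere given by a meromorphic function. -/
def toSphere (f : ℂ → ℂ) (z : ℂ) : Sphere :=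
  open Classical in if meromorphicOrderAt f z < 0 then ∞ else (f z : Sphere)

/-- `f` is a real function associated with the symmetric surface `(X, π, s)`: it is meromorphic in
the plane and `f = π ∘ φ` for a uniformizing homeomorphism `φ : ℂ → X` with `φ(z̄) = s(φ(z))`. The
map `φ` is conformal for the pulled back complex structure on `X` because `π ∘ φ` is meromorphic. -/
def IsAssociatedFunction {X : Type*} [TopologicalSpace X] (π : X → Sphere) (s : X → X)
    (f : ℂ → ℂ) : Prop :=
  MeromorphicOn f Set.univ ∧ ∃ φ : ℂ ≃ₜ X,
    (∀ z, φ (starRingEnd ℂ z) = s (φ z)) ∧ ∀ z, π (φ z) = toSphere f z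

end NSurface

end

section

open Topology Set

open scoped OnePoint

noncomputable section

namespace NSurface

/-! ### Connected components of subsets -/

section Components

variable {Y : Type*} [TopologicalSpace Y]

/-! Since `0` is not moved, the zeros of `f` correspond under `φ` to the points over `0` of the
deformed map `π*`, and a zero is real exactly when its point is fixed by `s`. So the question is
whether `s` fixes the fibre of `π*` over `0`.

Two facts about faces labeled by `0` decide it. First, a face containing a point over `0` is the
image of a section over the base face. It is therefore mapped injectively, has exactly one vertex of
each kind on its boundary, and is bounded (`exists_section`, `cross_unique`, `finite_boundary`).
Second, a face without such a point has infinitely many vertices (`exists_mem_center`). Otherwise it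
would be a finite covering of a punctured disc with unfilled puncture, hence a neighbourhood of
infinity in the plane `X` (`exists_isCompact_compl_subset`). All vertices would then lie in a
compact set and be finite in number, whereas a logarithmic end already carries infinitely many.
Moreover each vertex lies on the boundary of exactly one face labeled by `0` (`exists_face`,
`face_unique`).

If all zeros are real, take a vertex and its `0`-face `F`. Either `F` is unbounded, or it contains a
zero; that zero is fixed by `s`, so `s` preserves `F` and hence its unique vertex of the given kind.
Conversely, let `x` be a zero and `F` its face, and take the vertex over `×` on the boundary of `F`.
Its only `0`-face is `F`, which is bounded, so the vertex is on the axis. By uniqueness `s`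
preserves `F`, and since `x` and `s x` have the same image, injectivity gives `s x = x`.

The remaining work is to show that `π*` is a local homeomorphism with local sections away from the
new base points (`isLocalHomeomorph_map`, `locallySectioned_map`). Locally `π*` is `ψ ∘ π` for a
homeomorphism `ψ` of the sphere. The delicate places are the boundaries of the discs, where several
discs may touch. -/

theorem connectedComponentIn_eq_of_isOpen {S T : Set Y} {x : Y} (hS : IsPreconnected S)
    (ho : IsOpen S) (hx : x ∈ S) (hST : S ⊆ T) (hc : closure S ∩ T ⊆ S) :
    connectedComponentIn T x = S := by
  apply Subset.antisymm _ (hS.subset_connectedComponentIn hx hST)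
  refine IsPreconnected.subset_left_of_subset_union ho (isClosed_closure (s := S)).isOpen_compl ?_ ?_
    ⟨x, mem_connectedComponentIn (hST hx), hx⟩ isPreconnected_connectedComponentIn
  · exact disjoint_compl_right.mono_left subset_closure
  · intro y hy
    by_cases h : y ∈ closure S
    · exact Or.inl (hc ⟨h, connectedComponentIn_subset _ _ hy⟩)
    · exact Or.inr h

theorem mem_connectedComponentIn_of_mem_closure {T : Set Y} {x u : Y} (hx : x ∈ T)
    (hu : u ∈ closure (connectedComponentIn T x)) (huT : u ∈ T) :
    u ∈ connectedComponentIn T x := by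
  have h1 : IsPreconnected (insert u (connectedComponentIn T x)) :=
    isPreconnected_connectedComponentIn.subset_closure (subset_insert _ _)
      (insert_subset hu subset_closure)
  exact h1.subset_connectedComponentIn (mem_insert_of_mem _ (mem_connectedComponentIn hx))
    (insert_subset huT (connectedComponentIn_subset _ _)) (mem_insert _ _)

theorem IsComponentOf.eq_of_mem {T C : Set Y} (h : IsComponentOf T C) {x : Y} (hx : x ∈ C) :
    C = connectedComponentIn T x := by
  obtain ⟨y, _, rfl⟩ := h
  exact connectedComponentIn_eq hx

theorem IsComponentOf.subset {T C : Set Y} (h : IsComponentOf T C) : C ⊆ T := by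
  obtain ⟨y, _, rfl⟩ := h
  exact connectedComponentIn_subset _ _

theorem IsComponentOf.isPreconnected {T C : Set Y} (h : IsComponentOf T C) :
    IsPreconnected C := by
  obtain ⟨y, _, rfl⟩ := h
  exact isPreconnected_connectedComponentIn

theorem IsComponentOf.isOpen [LocallyConnectedSpace Y] {T C : Set Y} (h : IsComponentOf T C)
    (hT : IsOpen T) : IsOpen C := by
  obtain ⟨y, _, rfl⟩ := h
  exact hT.connectedComponentIn

theorem IsComponentOf.nonempty {T C : Set Y} (h : IsComponentOf T C) : C.Nonempty := by
  obtain ⟨y, hy, rfl⟩ := h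
  exact ⟨y, mem_connectedComponentIn hy⟩

theorem IsComponentOf.subset_of_isPreconnected {T C S : Set Y} (h : IsComponentOf T C)
    (hS : IsPreconnected S) (hST : S ⊆ T) {x : Y} (hxS : x ∈ S) (hxC : x ∈ C) : S ⊆ C := by
  rw [h.eq_of_mem hxC]
  exact hS.subset_connectedComponentIn hxS hST

theorem IsComponentOf.mem_of_mem_closure {T C : Set Y} (h : IsComponentOf T C) {u : Y}
    (hu : u ∈ closure C) (huT : u ∈ T) : u ∈ C := by
  obtain ⟨y, hy, rfl⟩ := h
  exact mem_connectedComponentIn_of_mem_closure hy hu huT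

theorem IsComponentOf.eq_of_mem_of_mem {T C C' : Set Y} (h : IsComponentOf T C)
    (h' : IsComponentOf T C') {x : Y} (hx : x ∈ C) (hx' : x ∈ C') : C = C' := by
  rw [h.eq_of_mem hx, h'.eq_of_mem hx']

theorem IsComponentOf.mem_of_path {T C : Set Y} (h : IsComponentOf T C) {Γ : unitInterval → Y}
    (hΓ : Continuous Γ) (hT : ∀ t, Γ t ∈ T) {a : unitInterval} (ha : Γ a ∈ C) (b : unitInterval) :
    Γ b ∈ C :=
  h.subset_of_isPreconnected (isPreconnected_range hΓ) (range_subset_iff.2 hT) (mem_range_self a) ha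
    (mem_range_self b)

theorem isComponentOf_connectedComponentIn {T : Set Y} {x : Y} (hx : x ∈ T) :
    IsComponentOf T (connectedComponentIn T x) := ⟨x, hx, rfl⟩

theorem IsComponentOf.image_homeomorph {Z : Type*} [TopologicalSpace Z] (f : Y ≃ₜ Z)
    {T C : Set Y} (h : IsComponentOf T C) : IsComponentOf (f '' T) (f '' C) := by
  obtain ⟨y, hy, rfl⟩ := h
  exact ⟨f y, mem_image_of_mem _ hy, f.image_connectedComponentIn hy⟩

end Components

/-! ### Path lifting from local sections -/

section Lifting

variable {X Y : Type*} [TopologicalSpace X] [TopologicalSpace Y]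

/-- Through every point over `N` there passes a continuous section of `p` over `N`. -/
def HasSectionsOver (p : X → Y) (N : Set Y) : Prop :=
  ∀ x, p x ∈ N → ∃ σ : Y → X, ContinuousOn σ N ∧ (∀ z ∈ N, p (σ z) = z) ∧ σ (p x) = x

theorem HasSectionsOver.mono {p : X → Y} {N N' : Set Y} (h : HasSectionsOver p N)
    (hN : N' ⊆ N) : HasSectionsOver p N' := fun x hx =>
  let ⟨σ, h1, h2, h3⟩ := h x (hN hx)
  ⟨σ, h1.mono hN, fun z hz => h2 z (hN hz), h3⟩

/-- Every point of `T` has a neighbourhood over which `p` has sections through all points. -/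
def LocallySectioned (p : X → Y) (T : Set Y) : Prop :=
  ∀ y ∈ T, ∃ N ∈ 𝓝 y, HasSectionsOver p N

theorem LocallySectioned.mono {p : X → Y} {T T' : Set Y} (h : LocallySectioned p T)
    (hT : T' ⊆ T) : LocallySectioned p T' := fun y hy => h y (hT hy)

/-- A trivialization gives the constant sheet through each point. Only this weaker consequence of
the covering property has to be carried through the deformation. -/
theorem _root_.IsCoveringMapOn.locallySectioned {p : X → Y} {T : Set Y}
    (h : IsCoveringMapOn p T) : LocallySectioned p T := by
  intro y hy
  obtain ⟨_, U, hyU, hU, _, H, hH⟩ := h y hy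
  refine ⟨U, hU.mem_nhds hyU, fun x hx => ?_⟩
  classical
  refine ⟨fun z => if hz : z ∈ U then (H.symm (⟨z, hz⟩, (H ⟨x, hx⟩).2)).1 else x, ?_, ?_, ?_⟩
  · rw [continuousOn_iff_continuous_domRestrict]
    have : Continuous fun z : U => (H.symm (z, (H ⟨x, hx⟩).2)).1 := by fun_prop
    refine this.congr fun z => ?_
    simp [domRestrict]
  · intro z hz
    simp only [hz, dif_pos]
    have := hH (H.symm (⟨z, hz⟩, (H ⟨x, hx⟩).2))
    rw [← this]; simp
  · dsimp only
    rw [dif_pos hx]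
    have : (⟨p x, hx⟩ : U) = (H ⟨x, hx⟩).1 := Subtype.ext (hH ⟨x, hx⟩).symm
    rw [this]; simp

/-- Subdivide the interval so that each piece is mapped into a single sectioned neighbourhood, and
continue the lift by the section through its current endpoint. -/
theorem LocallySectioned.exists_lift {p : X → Y} {T : Set Y} (h : LocallySectioned p T)
    (γ : C(unitInterval, Y)) (hγ : ∀ t, γ t ∈ T) (x : X) (hx : p x = γ 0) :
    ∃ Γ : C(unitInterval, X), Γ 0 = x ∧ ∀ t, p (Γ t) = γ t := by
  choose N hN hS using fun t => h (γ t) (hγ t)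
  obtain ⟨t, t_0, t_mono, ⟨n_max, h_max⟩, t_sub⟩ :=
    exists_monotone_Icc_subset_open_cover_unitInterval
    (fun s => (isOpen_interior (s := N s)).preimage γ.continuous)
    fun t _ => Set.mem_iUnion.2 ⟨t, mem_interior_iff_mem_nhds.2 (hN t)⟩
  suffices H : ∀ n, ∃ Γ : unitInterval → X, ContinuousOn Γ (Set.Icc 0 (t n)) ∧
      (∀ s ∈ Set.Icc 0 (t n), p (Γ s) = γ s) ∧ Γ 0 = x by
    obtain ⟨Γ, cont, hl, h0⟩ := H n_max
    rw [h_max _ le_rfl] at cont hl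
    have hu : Set.Icc (0 : unitInterval) 1 = univ := eq_univ_of_forall fun t => ⟨bot_le, le_top⟩
    rw [hu] at cont hl
    exact ⟨⟨Γ, continuousOn_univ.mp cont⟩, h0, fun t => hl t (mem_univ _)⟩
  intro n
  induction n with
  | zero =>
    refine ⟨fun _ => x, continuousOn_const, fun s hs => ?_, rfl⟩
    rw [t_0, Set.Icc_self, Set.mem_singleton_iff] at hs
    rw [hs, hx]
  | succ n ih =>
    obtain ⟨Γ, cont, hl, h0⟩ := ih
    obtain ⟨i, hi⟩ := t_sub n
    have h0n : (0 : unitInterval) ≤ t n := bot_le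
    have htn : p (Γ (t n)) = γ (t n) := hl _ ⟨h0n, le_rfl⟩
    have hmem : γ (t n) ∈ N i := interior_subset (hi ⟨le_rfl, t_mono n.le_succ⟩)
    obtain ⟨σ, hσ, hσ', hσx⟩ := hS i (Γ (t n)) (htn ▸ hmem)
    refine ⟨fun s => if s ≤ t n then Γ s else σ (γ s), ?_, ?_, ?_⟩
    · refine ContinuousOn.if (fun s hs => ?_) (cont.mono fun s hs => ?_) ?_
      · have : s = t n := frontier_Iic_subset _ hs.2
        rw [this, ← htn, hσx]
      · rw [closure_le_eq continuous_id' continuous_const] at hs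
        exact ⟨hs.1.1, hs.2⟩
      · refine hσ.comp γ.continuous.continuousOn fun s hs => ?_
        simp_rw [not_le] at hs
        have hs' : t n ≤ s := closure_lt_subset_le (f := fun _ : unitInterval => t n)
          (g := fun a => a) continuous_const continuous_id hs.2
        exact interior_subset (hi ⟨hs', hs.1.2⟩)
    · intro s hs
      dsimp only
      split_ifs with hsn
      · exact hl s ⟨hs.1, hsn⟩
      · exact hσ' _ (interior_subset (hi ⟨le_of_not_ge hsn, hs.2⟩))
    · simp [h0n, h0]

theorem eq_of_lifts_eq [T2Space X] {p : X → Y} (hp : IsLocalHomeomorph p)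
    {Γ Γ' : unitInterval → X} (hΓ : Continuous Γ) (hΓ' : Continuous Γ') (h : ∀ t, p (Γ t) = p (Γ' t)) {a : unitInterval}
    (ha : Γ a = Γ' a) (b : unitInterval) : Γ b = Γ' b :=
  congr_fun ((T2Space.isSeparatedMap p).eq_of_comp_eq hp.isLocallyInjective hΓ hΓ'
    (funext h) a ha) b

end Lifting

/-! ### Local homeomorphisms over a disc with one exceptional point -/

section Disc

variable {X Y : Type*} [TopologicalSpace X] [T2Space X] [TopologicalSpace Y] {p : X → Y}

/-- Paths that start at the centre of a disc and run along a ray lift. -/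
theorem exists_radial_lift (hp : IsLocalHomeomorph p) {e : ℂ → Y} (he : IsOpenEmbedding e)
    (hs : LocallySectioned p (range e \ {e 0})) {x : X} (hx : p x = e 0) (w : ℂ) :
    ∃ Γ : C(unitInterval, X), Γ 0 = x ∧ ∀ t : unitInterval, p (Γ t) = e (((t : ℝ) : ℂ) * w) := by
  rcases eq_or_ne w 0 with rfl | hw
  · exact ⟨ContinuousMap.const _ x, rfl, fun t => by simp [hx]⟩
  obtain ⟨q, hxq, rfl⟩ := hp x
  have hopen : IsOpen {t : ℝ | e ((t : ℂ) * w) ∈ q.target} :=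
    q.open_target.preimage (he.continuous.comp (by fun_prop))
  have h0 : (0 : ℝ) ∈ {t : ℝ | e ((t : ℂ) * w) ∈ q.target} := by
    simp only [mem_ofPred_eq, Complex.ofReal_zero, zero_mul, ← hx]
    exact q.map_source hxq
  obtain ⟨δ, hδ, hball⟩ := Metric.isOpen_iff.1 hopen 0 h0
  set ε : ℝ := δ / 2 with hε
  have hεpos : 0 < ε := by positivity
  have hin : ∀ t : ℝ, 0 ≤ t → t ≤ ε → e ((t : ℂ) * w) ∈ q.target := fun t h1 h2 =>
    hball (by rw [Metric.mem_ball, Real.dist_eq, sub_zero, abs_of_nonneg h1]; linarith)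
  -- Freezing the path up to time `ε` keeps it away from the centre, where no sections are assumed.
  -- The initial segment is lifted by the local inverse instead, and the two lifts are glued at `t =
  -- ε`.
  let γ : C(unitInterval, Y) := ⟨fun t => e ((max (t : ℝ) ε : ℝ) * w), he.continuous.comp (by fun_prop)⟩
  obtain ⟨Γ, hΓ0, hΓ⟩ := hs.exists_lift γ (fun t => ⟨mem_range_self _, fun h => by
      have h2 := he.injective h
      have h3 : max (t : ℝ) ε ≠ 0 := (lt_of_lt_of_le hεpos (le_max_right _ _)).ne'
      simp only [mul_eq_zero, hw, or_false, Complex.ofReal_eq_zero] at h2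
      exact h3 h2⟩) (q.symm (e ((ε : ℂ) * w))) (by
      rw [q.right_inv (hin ε hεpos.le le_rfl)]
      simp [γ, hεpos.le])
  have hsymm : Continuous fun t : unitInterval => q.symm (e ((min (t : ℝ) ε : ℝ) * w)) := by
    refine q.continuousOn_symm.comp_continuous (he.continuous.comp (by fun_prop)) fun t => ?_
    exact hin _ (le_min t.2.1 hεpos.le) (min_le_right _ _)
  have hloc : ∀ t : unitInterval, (t : ℝ) ≤ ε → Γ t = q.symm (e ((ε : ℂ) * w)) := by
    intro t ht
    have := eq_of_lifts_eq hp (Γ := fun s => Γ ⟨min (t : ℝ) s, le_min t.2.1 s.2.1,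
      (min_le_left _ _).trans t.2.2⟩) (Γ' := fun s => Γ 0) (by fun_prop) continuous_const
      (fun s => by
        rw [hΓ, hΓ]
        have : min (t : ℝ) s ≤ ε := (min_le_left _ _).trans ht
        simp [γ, this, hεpos.le]) (a := 0) (by
          congr 1
          ext
          simp [t.2.1]) 1
    rw [hΓ0] at this
    rw [← this]
    congr 1
    ext
    simp [t.2.2]
  refine ⟨⟨fun t => if (t : ℝ) ≤ ε then q.symm (e ((min (t : ℝ) ε : ℝ) * w)) else Γ t,
    Continuous.if_le hsymm Γ.continuous continuous_subtype_val continuous_const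
      fun t ht => ?_⟩, ?_, ?_⟩
  · rw [hloc t ht.le, ht, min_self]
  · have h1 : e 0 ∈ q.target := by simpa using h0
    have : ((0 : unitInterval) : ℝ) ≤ ε := hεpos.le
    simp only [ContinuousMap.coe_mk, if_pos this]
    simp only [Icc.coe_zero, min_eq_left hεpos.le, Complex.ofReal_zero, zero_mul]
    rw [← hx, q.left_inv hxq]
  · intro t
    simp only [ContinuousMap.coe_mk]
    split_ifs with h
    · rw [min_eq_left h, q.right_inv (hin _ t.2.1 h)]
    · rw [hΓ]
      simp [γ, max_eq_left (le_of_not_ge h)]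

/-- If the centre of a disc is the only ramification value in it, then there is a section over the
disc through every point over the centre. -/
theorem exists_section_disc (hp : IsLocalHomeomorph p) {e : ℂ → Y} (he : IsOpenEmbedding e)
    (hs : LocallySectioned p (range e \ {e 0})) {x : X} (hx : p x = e 0) :
    ∃ σ : ℂ → X, Continuous σ ∧ (∀ w, p (σ w) = e w) ∧ σ 0 = x := by
  choose Γ hΓ0 hΓ using exists_radial_lift hp he hs hx
  -- The radial lifts were chosen separately for each `w`. They all start at `x`, so homotopy
  -- lifting for local homeomorphisms makes them jointly continuous.
  have hc : Continuous fun z : unitInterval × ℂ => Γ z.2 z.1 := by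
    refine hp.continuous_lift (T2Space.isSeparatedMap p)
      (⟨fun z : unitInterval × ℂ => e (((z.1 : ℝ) : ℂ) * z.2), he.continuous.comp (by fun_prop)⟩ : C(unitInterval × ℂ, Y))
      ?_ ?_ ?_
    · ext z; exact hΓ _ _
    · simp only [hΓ0]; exact continuous_const
    · intro a; exact (Γ a).continuous
  refine ⟨fun w => Γ w 1, hc.comp (Continuous.prodMk_right 1), fun w => by simp [hΓ], ?_⟩
  have := eq_of_lifts_eq hp (Γ 0).continuous (Γ' := fun _ => x) continuous_const
    (fun t => by rw [hΓ, hx]; simp) (hΓ0 0) 1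
  exact this

omit [T2Space X] in
theorem isOpenEmbedding_section (hp : IsLocalHomeomorph p) {e : ℂ → Y} (he : IsOpenEmbedding e)
    {σ : ℂ → X} (hσ : Continuous σ) (h : ∀ w, p (σ w) = e w) : IsOpenEmbedding σ :=
  hp.isOpenEmbedding_of_comp (by rwa [show p ∘ σ = e from funext h]) hσ

/-- The image of a section over a disc is a component of the preimage of the disc. -/
theorem connectedComponentIn_eq_range_section (hp : IsLocalHomeomorph p) {e : ℂ → Y}
    (he : IsOpenEmbedding e) {σ : ℂ → X} (hσ : Continuous σ) (h : ∀ w, p (σ w) = e w) (w : ℂ) :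
    connectedComponentIn (p ⁻¹' range e) (σ w) = range σ := by
  refine connectedComponentIn_eq_of_isOpen (isPreconnected_range hσ)
    (isOpenEmbedding_section hp he hσ h).isOpen_range (mem_range_self _) ?_ ?_
  · rintro _ ⟨z, rfl⟩
    exact ⟨z, (h z).symm⟩
  · rintro u ⟨hu, ⟨z, hz⟩⟩
    refine ⟨z, ?_⟩
    by_contra hne
    obtain ⟨U, V, hU, hV, hzU, huV, hd⟩ := t2_separation hne
    -- A point `σ w₁` in this neighbourhood of `u` has `w₁ ∈ σ ⁻¹' U`, so it lies in both `U` and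
    -- `V`.
    have hA : IsOpen (V ∩ p ⁻¹' (e '' (σ ⁻¹' U))) :=
      hV.inter ((he.isOpenMap _ (hU.preimage hσ)).preimage hp.continuous)
    obtain ⟨_, ⟨hV', ⟨w', hw', hw''⟩⟩, ⟨w₁, rfl⟩⟩ := mem_closure_iff.1 hu _ hA ⟨huV, z, hzU, hz⟩
    rw [h] at hw''
    rw [he.injective hw''] at hw'
    exact disjoint_left.1 hd hw' hV'

/-- The preimage of a circle under a finite covering of a punctured disc is compact. -/
theorem isCompact_inter_preimage_sphere (hp : IsLocalHomeomorph p) {e : ℂ → Y}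
    (he : IsOpenEmbedding e) (hs : LocallySectioned p (range e \ {e 0})) {F : Set X}
    (hF : IsComponentOf (p ⁻¹' range e) F) {r : ℝ} (hr : 0 < r)
    (hfin : {u ∈ F | p u = e r}.Finite) : IsCompact (F ∩ p ⁻¹' (e '' Metric.sphere 0 r)) := by
  have hne : ∀ θ : ℝ, (r : ℂ) * Complex.exp (θ * Complex.I) ≠ 0 := fun θ =>
    mul_ne_zero (by exact_mod_cast hr.ne') (Complex.exp_ne_zero _)
  let c : ℝ → Y := fun θ => e (r * Complex.exp (θ * Complex.I))
  have hc : Continuous c := he.continuous.comp (by fun_prop)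
  have hcm : ∀ θ, c θ ∈ range e \ {e 0} := fun θ =>
    ⟨mem_range_self _, fun h => hne θ (he.injective h)⟩
  have hlift : ∀ u : {u ∈ F | p u = e r}, ∃ Γ : C(unitInterval, X), Γ 0 = u ∧
      ∀ t : unitInterval, p (Γ t) = c (2 * Real.pi * t) := fun u =>
    hs.exists_lift ⟨fun t => c (2 * Real.pi * t), hc.comp (by fun_prop)⟩ (fun t => hcm _) u
      (by rw [u.2.2]; simp [c])
  choose Γ hΓ0 hΓ using hlift
  have : Finite {u ∈ F | p u = e r} := hfin
  have heq : F ∩ p ⁻¹' (e '' Metric.sphere 0 r) = ⋃ u, range (Γ u) := by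
    apply Subset.antisymm
    · rintro k ⟨hkF, w, hw, hwk⟩
      obtain ⟨θ, hθ, hθw⟩ : ∃ θ ∈ Icc (0 : ℝ) 1, (r : ℂ) * Complex.exp
          ((2 * Real.pi * θ : ℝ) * Complex.I) = w := by
        have hpi := Real.pi_pos
        have hnorm : ‖w‖ = r := by simpa using hw
        set a := toIcoMod Real.two_pi_pos 0 w.arg with ha
        have ham : a ∈ Ico (0 : ℝ) (0 + 2 * Real.pi) := toIcoMod_mem_Ico _ _ _
        refine ⟨a / (2 * Real.pi), ⟨by have := ham.1; positivity,
          (div_le_one (by positivity)).2 (by linarith [ham.2])⟩, ?_⟩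
        rw [mul_div_cancel₀ _ (by positivity)]
        rw [← hnorm]
        conv_rhs => rw [← Complex.norm_mul_exp_arg_mul_I w]
        have : w.arg = a + toIcoDiv Real.two_pi_pos 0 w.arg • (2 * Real.pi) :=
          (toIcoMod_add_toIcoDiv_zsmul _ _ _).symm
        rw [this]
        push_cast
        rw [add_mul, Complex.exp_add]
        have h2 : Complex.exp (toIcoDiv Real.two_pi_pos 0 w.arg • (2 * (Real.pi : ℂ)) *
            Complex.I) = 1 := by
          rw [Complex.exp_eq_one_iff]
          exact ⟨toIcoDiv Real.two_pi_pos 0 w.arg, by simp; ring⟩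
        simp only [zsmul_eq_mul] at h2 ⊢
        rw [h2, mul_one]
      -- From `k`, run back along the circle to angle `0`. Reversed, this lift is an initial piece
      -- of the full turn `Γ` that starts at its endpoint.
      obtain ⟨Λ, hΛ0, hΛ⟩ := hs.exists_lift ⟨fun t : unitInterval =>
        c (2 * Real.pi * (θ * (1 - t))), hc.comp (by fun_prop)⟩ (fun t => hcm _) k
        (by rw [← hwk, ← hθw]; simp [c])
      have hΛF : Λ 1 ∈ F := hF.mem_of_path Λ.continuous
        (fun t => by rw [mem_preimage, hΛ]; exact (hcm _).1) (a := 0) (by rwa [hΛ0]) 1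
      have hΛ1 : p (Λ 1) = e r := by rw [hΛ]; simp [c]
      have key := eq_of_lifts_eq hp (Γ := fun t : unitInterval => Γ ⟨Λ 1, hΛF, hΛ1⟩
        ⟨θ * (1 - t), mul_nonneg hθ.1 (by linarith [t.2.2]),
          mul_le_one₀ hθ.2 (by linarith [t.2.2]) (by linarith [t.2.1])⟩) (Γ' := Λ) (by fun_prop)
        Λ.continuous (fun t => by rw [hΓ, hΛ]; rfl) (a := 1)
        (by
          convert hΓ0 ⟨Λ 1, hΛF, hΛ1⟩ using 2
          ext; simp) 0
      rw [hΛ0] at key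
      rw [← key]
      exact mem_iUnion.2 ⟨_, mem_range_self _⟩
    · refine iUnion_subset fun u => range_subset_iff.2 fun t => ⟨?_, ?_⟩
      · exact hF.mem_of_path (Γ u).continuous
          (fun t => by rw [mem_preimage, hΓ]; exact (hcm _).1) (a := 0) (by rw [hΓ0]; exact u.2.1) t
      · rw [mem_preimage, hΓ]
        refine mem_image_of_mem e ?_
        rw [mem_sphere_zero_iff_norm, norm_mul, Complex.norm_exp_ofReal_mul_I]
        simp [hr.le]
  rw [heq]
  exact isCompact_iUnion fun u => isCompact_range (Γ u).continuous

/-- The exterior of the disc is the image of a half-plane under the exponential. -/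
theorem isPreconnected_compl_closedBall {R : ℝ} (hR : 0 < R) :
    IsPreconnected (Metric.closedBall (0 : ℂ) R)ᶜ := by
  have : (Metric.closedBall (0 : ℂ) R)ᶜ = Complex.exp '' {z | Real.log R < z.re} := by
    ext z
    simp only [mem_compl_iff, mem_closedBall_zero_iff, not_le, mem_image, mem_ofPred_eq]
    constructor
    · intro h
      have hz : z ≠ 0 := norm_pos_iff.1 (hR.trans h)
      exact ⟨Complex.log z, by rw [Complex.log_re]; exact Real.log_lt_log hR h,
        Complex.exp_log hz⟩
    · rintro ⟨w, hw, rfl⟩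
      rw [Complex.norm_exp]
      exact (Real.log_lt_iff_lt_exp hR).1 hw
  rw [this]
  exact (convex_halfSpace_re_gt _).isPreconnected.image _ Complex.continuous_exp.continuousOn

/-- A finite covering of a punctured disc by a region in a plane whose puncture is not filled is a
neighbourhood of infinity. -/
theorem exists_isCompact_compl_subset [T2Space Y] (hp : IsLocalHomeomorph p) (φ : ℂ ≃ₜ X)
    {e : ℂ → Y} (he : IsOpenEmbedding e) (hs : LocallySectioned p (range e \ {e 0})) {F : Set X}
    (hF : IsComponentOf (p ⁻¹' range e) F) (h0 : ∀ u ∈ F, p u ≠ e 0) {r : ℝ} (hr : 0 < r)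
    (hfin : {u ∈ F | p u = e r}.Finite) :
    ∃ K, IsCompact K ∧ Kᶜ ⊆ F ∩ p ⁻¹' (e '' Metric.ball 0 r) := by
  have : LocallyConnectedSpace X := φ.symm.isOpenEmbedding.locallyConnectedSpace
  set C := F ∩ p ⁻¹' (e '' Metric.sphere 0 r)
  set V := F ∩ p ⁻¹' (e '' Metric.ball 0 r) with hV
  have hC : IsCompact C := isCompact_inter_preimage_sphere hp he hs hF hr hfin
  have hFo : IsOpen F := hF.isOpen (he.isOpen_range.preimage hp.continuous)
  have hVo : IsOpen V := hFo.inter ((he.isOpenMap _ Metric.isOpen_ball).preimage hp.continuous)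
  have hcl : closure V ⊆ V ∪ C := by
    intro u hu
    have h1 : IsClosed (p ⁻¹' (e '' Metric.closedBall 0 r)) :=
      ((isCompact_closedBall _ _).image he.continuous).isClosed.preimage hp.continuous
    have h2 : u ∈ p ⁻¹' (e '' Metric.closedBall 0 r) :=
      closure_minimal (fun v (hv : v ∈ V) =>
        preimage_mono (image_mono Metric.ball_subset_closedBall) hv.2) h1 hu
    obtain ⟨w, hw, hwu⟩ := h2
    have h3 : u ∈ F := hF.mem_of_mem_closure (closure_mono inter_subset_left hu) ⟨w, hwu⟩
    rcases (mem_closedBall_zero_iff.1 hw).lt_or_eq with h | h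
    · exact Or.inl ⟨h3, w, mem_ball_zero_iff.2 h, hwu⟩
    · exact Or.inr ⟨h3, w, mem_sphere_zero_iff_norm.2 h, hwu⟩
  -- If `V` were relatively compact, `p '' closure V` would be closed. It contains `e (δ * w)` for
  -- all small `δ > 0`, hence also `e 0`, which `F` omits.
  have hunb : ∀ K, IsCompact K → ¬ V ⊆ K := by
    intro K hK hVK
    have hcV : IsCompact (closure V) := hK.of_isClosed_subset isClosed_closure
      (closure_minimal hVK hK.isClosed)
    have hcomp := (hcV.image hp.continuous).isClosed
    obtain ⟨u, hu⟩ := hF.nonempty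
    obtain ⟨w, hw⟩ : p u ∈ range e := hF.subset hu
    have hw0 : w ≠ 0 := by
      rintro rfl
      exact h0 u hu hw.symm
    have hpath : ∀ δ : ℝ, 0 < δ → ∃ v ∈ F, p v = e (δ * w) := by
      intro δ hδ
      have hpos : ∀ t : unitInterval, 0 < (1 - (t : ℝ)) + t * δ := by
        intro t
        rcases t.2.1.eq_or_lt with h | h
        · rw [← h]; norm_num
        · have := mul_pos h hδ
          linarith [t.2.2]
      have hm : ∀ t : unitInterval, e (((1 - (t : ℝ)) + t * δ : ℝ) * w) ∈ range e \ {e 0} :=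
        fun t => ⟨mem_range_self _, fun h => by
          have := he.injective h
          simp only [mul_eq_zero, hw0, or_false, Complex.ofReal_eq_zero] at this
          exact (hpos t).ne' this⟩
      obtain ⟨Λ, hΛ0, hΛ⟩ := hs.exists_lift ⟨fun t : unitInterval =>
        e (((1 - (t : ℝ)) + t * δ : ℝ) * w), he.continuous.comp (by fun_prop)⟩ hm u (by simp [hw])
      refine ⟨Λ 1, hF.mem_of_path Λ.continuous (fun t => by
        rw [mem_preimage, hΛ]; exact (hm t).1) (a := 0) (by rwa [hΛ0]) 1, by rw [hΛ]; simp⟩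
    have hmem : e 0 ∈ p '' closure V := by
      have ht : Filter.Tendsto (fun δ : ℝ => e (δ * w)) (𝓝[>] 0) (𝓝 (e 0)) := by
        have : Continuous fun δ : ℝ => e (δ * w) := he.continuous.comp (by fun_prop)
        have h := this.tendsto 0
        simp only [Complex.ofReal_zero, zero_mul] at h
        exact h.mono_left nhdsWithin_le_nhds
      refine hcomp.mem_of_tendsto ht ?_
      have hsmall : ∀ᶠ δ : ℝ in 𝓝[>] 0, (δ : ℂ) * w ∈ Metric.ball (0 : ℂ) r := by
        have : Continuous fun δ : ℝ => (δ : ℂ) * w := by fun_prop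
        have h := this.tendsto 0
        simp only [Complex.ofReal_zero, zero_mul] at h
        exact (h.mono_left nhdsWithin_le_nhds) (Metric.ball_mem_nhds _ hr)
      filter_upwards [hsmall, self_mem_nhdsWithin] with δ h1 h2
      obtain ⟨v, hv, hv'⟩ := hpath δ h2
      exact ⟨v, subset_closure ⟨hv, _, h1, hv'.symm⟩, hv'⟩
    obtain ⟨x, hx, hx0⟩ := hmem
    exact h0 x ((hcl hx).elim (fun h => h.1) fun h => h.1) hx0
  obtain ⟨R, hR⟩ := (hC.image φ.symm.continuous).isBounded.subset_closedBall (0 : ℂ)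
  set R' := max R 1
  have hR' : φ.symm '' C ⊆ Metric.closedBall 0 R' :=
    hR.trans (Metric.closedBall_subset_closedBall (le_max_left _ _))
  have hKc : IsCompact (φ '' Metric.closedBall 0 R') :=
    (isCompact_closedBall _ _).image φ.continuous
  refine ⟨φ '' Metric.closedBall 0 R', hKc, ?_⟩
  have hZ : IsPreconnected (φ '' Metric.closedBall 0 R')ᶜ := by
    rw [← image_compl_eq φ.bijective]
    exact (isPreconnected_compl_closedBall (lt_of_lt_of_le one_pos (le_max_right _ _))).image _
      φ.continuous.continuousOn
  -- The exterior `Z` of a large disc avoids `C`, so the disjoint open sets `V` and `(closure V)ᶜ`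
  -- cover it. It is connected and meets the unbounded set `V`, so it lies in `V`.
  refine IsPreconnected.subset_left_of_subset_union hVo (isClosed_closure (s := V)).isOpen_compl
    (disjoint_compl_right.mono_left subset_closure) ?_ ?_ hZ
  · intro z hz
    by_cases h : z ∈ closure V
    · refine Or.inl ((hcl h).resolve_right fun hzC => hz ?_)
      exact ⟨φ.symm z, hR' (mem_image_of_mem _ hzC), by simp⟩
    · exact Or.inr h
  · obtain ⟨z, hz, hzK⟩ := not_subset.1 (hunb _ hKc)
    exact ⟨z, hzK, hz⟩

end Disc

/-! ### Conjugation, reflection and round discs on the sphere -/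

section Sphere

@[simp] theorem conj_coe (z : ℂ) : conj (z : Sphere) = ((starRingEnd ℂ z : ℂ) : Sphere) := rfl

@[simp] theorem conj_infty : conj ∞ = ∞ := rfl

theorem conj_conj (y : Sphere) : conj (conj y) = y := by
  induction y using OnePoint.rec with
  | infty => rfl
  | coe z => simp

/-- Complex conjugation as a homeomorphism of the sphere. -/
def conjHomeo : Sphere ≃ₜ Sphere := Complex.conjCLE.toHomeomorph.onePointCongr

theorem continuous_conj : Continuous conj := conjHomeo.continuous

/-- The reflection in the unit circle. -/
def reflection (y : Sphere) : Sphere :=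
  open Classical in
  y.elim ((0 : ℂ) : Sphere) fun z => if z = 0 then ∞ else (((starRingEnd ℂ z)⁻¹ : ℂ) : Sphere)

@[simp] theorem reflection_infty : reflection ∞ = ((0 : ℂ) : Sphere) := rfl

@[simp] theorem reflection_zero : reflection ((0 : ℂ) : Sphere) = ∞ := by
  simp [reflection]

theorem reflection_coe {z : ℂ} (hz : z ≠ 0) :
    reflection (z : Sphere) = (((starRingEnd ℂ z)⁻¹ : ℂ) : Sphere) := by
  simp [reflection, hz]

theorem reflection_reflection (y : Sphere) : reflection (reflection y) = y := by
  induction y using OnePoint.rec with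
  | infty => simp
  | coe z =>
    rcases eq_or_ne z 0 with rfl | hz
    · simp
    · rw [reflection_coe hz, reflection_coe (by simpa using hz)]
      simp

theorem continuous_reflection : Continuous reflection := by
  rw [OnePoint.continuous_iff, Filter.coclosedCompact_eq_cocompact]
  constructor
  · have h : Filter.Tendsto (fun z : ℂ => (starRingEnd ℂ z)⁻¹) (Filter.cocompact ℂ) (𝓝 0) :=
      (Filter.tendsto_inv₀_cobounded (α := ℂ)).comp
        (by
          have := Complex.conjCLE.toHomeomorph.isClosedEmbedding.tendsto_cocompact
          rw [← Metric.cobounded_eq_cocompact] at this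
          rw [← Metric.cobounded_eq_cocompact]
          exact this)
    have h2 := (OnePoint.continuous_coe.tendsto (0 : ℂ)).comp h
    refine h2.congr' ?_
    have : {(0 : ℂ)}ᶜ ∈ Filter.cocompact ℂ := isCompact_singleton.compl_mem_cocompact
    filter_upwards [this] with z hz
    simp [reflection_coe hz]
  · rw [continuous_iff_continuousAt]
    intro z
    rcases eq_or_ne z 0 with rfl | hz
    · rw [continuousAt_iff_punctured_nhds, reflection_zero]
      have h0 : Filter.Tendsto (starRingEnd ℂ) (𝓝[≠] 0) (𝓝[≠] 0) := by
        refine tendsto_nhdsWithin_iff.2 ⟨?_, ?_⟩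
        · have := Complex.continuous_conj.tendsto 0
          rw [map_zero] at this
          exact this.mono_left nhdsWithin_le_nhds
        · filter_upwards [self_mem_nhdsWithin] with z hz
          simpa using hz
      have h1 : Filter.Tendsto (fun z : ℂ => (starRingEnd ℂ z)⁻¹) (𝓝[≠] 0)
          (Filter.coclosedCompact ℂ) := by
        rw [Filter.coclosedCompact_eq_cocompact, ← Metric.cobounded_eq_cocompact]
        exact (Filter.tendsto_inv₀_nhdsNE_zero).comp h0
      refine (OnePoint.tendsto_coe_infty.comp h1).congr' ?_
      filter_upwards [self_mem_nhdsWithin] with z hz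
      exact (reflection_coe hz).symm
    · have : ContinuousAt (fun z : ℂ => (((starRingEnd ℂ z)⁻¹ : ℂ) : Sphere)) z :=
        OnePoint.continuous_coe.continuousAt.comp
          ((Complex.continuous_conj.continuousAt).inv₀ (by simpa using hz))
      refine this.congr ?_
      filter_upwards [isOpen_ne.mem_nhds hz] with w hw
      exact (reflection_coe hw).symm

/-- The reflection in the unit circle as a homeomorphism. -/
def reflectionHomeo : Sphere ≃ₜ Sphere where
  toFun := reflection
  invFun := reflection
  left_inv := reflection_reflection
  right_inv := reflection_reflection
  continuous_toFun := continuous_reflection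
  continuous_invFun := continuous_reflection

@[simp] theorem reflectionHomeo_apply (y : Sphere) : reflectionHomeo y = reflection y := rfl

theorem reflection_conj (y : Sphere) : reflection (conj y) = conj (reflection y) := by
  induction y using OnePoint.rec with
  | infty => simp
  | coe z =>
    rcases eq_or_ne z 0 with rfl | hz
    · simp
    · rw [reflection_coe hz, conj_coe, conj_coe, reflection_coe (by simpa using hz)]
      simp

theorem disc_coe (z : ℂ) (r : ℝ) :
    disc (z : Sphere) r = (fun w : ℂ => (w : Sphere)) '' Metric.ball z r := rfl

theorem disc_infty (r : ℝ) :
    disc ∞ r = ((fun w : ℂ => (w : Sphere)) '' Metric.closedBall 0 r⁻¹)ᶜ := rfl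

/-- This transports the chart of a disc about `0` to the discs about `∞`. -/
theorem disc_infty_eq_reflection {r : ℝ} (hr : 0 < r) :
    disc ∞ r = reflection '' disc ((0 : ℂ) : Sphere) r := by
  rw [disc_infty, disc_coe]
  ext y
  constructor
  · intro hy
    refine ⟨reflection y, ?_, reflection_reflection y⟩
    induction y using OnePoint.rec with
    | infty => exact ⟨0, by simpa using hr, rfl⟩
    | coe z =>
      have hz : r⁻¹ < ‖z‖ := by
        by_contra h
        exact hy ⟨z, by simpa using not_lt.1 h, rfl⟩
      have hz0 : z ≠ 0 := norm_pos_iff.1 ((inv_pos.2 hr).trans hz)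
      rw [reflection_coe hz0]
      refine ⟨_, ?_, rfl⟩
      simpa using inv_lt_of_inv_lt₀ hr hz
  · rintro ⟨_, ⟨w, hw, rfl⟩, rfl⟩
    rintro ⟨z, hz, hzw⟩
    rcases eq_or_ne w 0 with rfl | hw0
    · simp at hzw
    · rw [reflection_coe hw0] at hzw
      have := OnePoint.coe_injective hzw
      subst this
      simp only [Metric.mem_closedBall, dist_zero_right, norm_inv, RCLike.norm_conj,
        Metric.mem_ball] at hz hw
      have h1 := (inv_le_inv₀ (norm_pos_iff.2 hw0) hr).1 hz
      linarith

/-- Every disc on the sphere is parametrized by the plane. -/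
theorem exists_disc_chart (a : Sphere) {r : ℝ} (hr : 0 < r) :
    ∃ e : ℂ → Sphere, IsOpenEmbedding e ∧ e 0 = a ∧ range e = disc a r := by
  have key : ∀ z : ℂ, ∃ e : ℂ → Sphere, IsOpenEmbedding e ∧ e 0 = (z : Sphere) ∧
      range e = disc (z : Sphere) r := by
    intro z
    refine ⟨fun w => ((OpenPartialHomeomorph.univBall z r w : ℂ) : Sphere),
      OnePoint.isOpenEmbedding_coe.comp
        ((OpenPartialHomeomorph.univBall z r).isOpenEmbedding
          (OpenPartialHomeomorph.univBall_source z r)), ?_, ?_⟩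
    · simp
    · rw [disc_coe, ← OpenPartialHomeomorph.univBall_target z hr,
        ← (OpenPartialHomeomorph.univBall z r).image_source_eq_target,
        OpenPartialHomeomorph.univBall_source, image_image, image_univ]
  induction a using OnePoint.rec with
  | coe z => exact key z
  | infty =>
    obtain ⟨e, he, h0, hr'⟩ := key 0
    refine ⟨fun w => reflection (e w), reflectionHomeo.isOpenEmbedding.comp he, by simp [h0], ?_⟩
    rw [disc_infty_eq_reflection hr, ← hr', ← range_comp]
    rfl

theorem isOpen_disc (a : Sphere) (r : ℝ) : IsOpen (disc a r) := by
  induction a using OnePoint.rec with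
  | coe z => exact OnePoint.isOpenEmbedding_coe.isOpenMap _ Metric.isOpen_ball
  | infty =>
    exact ((isCompact_closedBall _ _).image OnePoint.continuous_coe).isClosed.isOpen_compl

theorem mem_disc_self (a : Sphere) {r : ℝ} (hr : 0 < r) : a ∈ disc a r := by
  obtain ⟨e, _, h0, h⟩ := exists_disc_chart a hr
  rw [← h, ← h0]
  exact mem_range_self _

theorem conj_mem_disc {a y : Sphere} {r : ℝ} (ha : conj a = a) (hy : y ∈ disc a r) :
    conj y ∈ disc a r := by
  induction a using OnePoint.rec with
  | coe z =>
    obtain ⟨w, hw, rfl⟩ := hy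
    refine ⟨starRingEnd ℂ w, ?_, rfl⟩
    have hz : starRingEnd ℂ z = z := OnePoint.coe_injective ha
    rw [Metric.mem_ball, ← hz, Complex.dist_conj_conj]
    exact hw
  | infty =>
    rintro ⟨w, hw, hwy⟩
    apply hy
    refine ⟨starRingEnd ℂ w, by simpa using hw, ?_⟩
    rw [← conj_conj y, ← hwy]
    rfl

/-- Discs are locally connected at their boundary. -/
theorem exists_isPreconnected_inter_disc {a y : Sphere} {r : ℝ} (hr : 0 < r) (hy : y ∉ disc a r)
    {U : Set Sphere} (hU : U ∈ 𝓝 y) :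
    ∃ W ∈ 𝓝 y, W ⊆ U ∧ IsPreconnected (W ∩ disc a r) := by
  induction y using OnePoint.rec with
  | infty =>
    induction a using OnePoint.rec with
    | infty => exact absurd (mem_disc_self _ hr) hy
    | coe z =>
      have hc : IsCompact ((fun w : ℂ => (w : Sphere)) '' Metric.closedBall z r) :=
        (isCompact_closedBall _ _).image OnePoint.continuous_coe
      refine ⟨U ∩ ((fun w : ℂ => (w : Sphere)) '' Metric.closedBall z r)ᶜ,
        Filter.inter_mem hU (hc.isClosed.isOpen_compl.mem_nhds (by simp)), inter_subset_left, ?_⟩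
      have : U ∩ ((fun w : ℂ => (w : Sphere)) '' Metric.closedBall z r)ᶜ ∩
          disc (z : Sphere) r = ∅ := by
        rw [eq_empty_iff_forall_notMem]
        rintro _ ⟨⟨_, h⟩, ⟨w, hw, rfl⟩⟩
        exact h ⟨w, Metric.ball_subset_closedBall hw, rfl⟩
      rw [this]
      exact isPreconnected_empty
  | coe y =>
    have hU' : (fun w : ℂ => (w : Sphere)) ⁻¹' U ∈ 𝓝 y :=
      OnePoint.continuous_coe.continuousAt hU
    induction a using OnePoint.rec with
    | coe z =>
      obtain ⟨δ, hδ, hb⟩ := Metric.mem_nhds_iff.1 hU'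
      refine ⟨(fun w : ℂ => (w : Sphere)) '' Metric.ball y δ,
        OnePoint.isOpenEmbedding_coe.image_mem_nhds.2 (Metric.ball_mem_nhds _ hδ),
        image_subset_iff.2 hb, ?_⟩
      rw [disc_coe, ← image_inter OnePoint.coe_injective]
      exact ((convex_ball _ _).inter (convex_ball _ _)).isPreconnected.image _
        OnePoint.continuous_coe.continuousOn
    | infty =>
      have hy0 : y ∈ Metric.closedBall (0 : ℂ) r⁻¹ := by
        by_contra h
        exact hy (by rw [disc_infty]; rintro ⟨w, hw, hwy⟩; exact h (OnePoint.coe_injective hwy ▸ hw))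
      rcases eq_or_ne y 0 with rfl | hyne
      · refine ⟨(fun w : ℂ => (w : Sphere)) '' (Metric.ball 0 r⁻¹ ∩
          (fun w : ℂ => (w : Sphere)) ⁻¹' U), OnePoint.isOpenEmbedding_coe.image_mem_nhds.2
          (Filter.inter_mem (Metric.ball_mem_nhds _ (inv_pos.2 hr)) hU'), ?_, ?_⟩
        · rintro _ ⟨w, hw, rfl⟩
          exact hw.2
        · convert isPreconnected_empty
          rw [eq_empty_iff_forall_notMem]
          rintro _ ⟨⟨w, hw, rfl⟩, h⟩
          rw [disc_infty] at h
          exact h ⟨w, Metric.ball_subset_closedBall hw.1, rfl⟩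
      -- In a logarithmic coordinate at `y` the disc about `∞` becomes a half-plane, so its trace on
      -- a small ball is convex.
      · let g : ℂ → Sphere := fun w => ((y * Complex.exp w : ℂ) : Sphere)
        have hg : Continuous g := OnePoint.continuous_coe.comp (by fun_prop)
        have hgo : IsOpenMap g := by
          refine OnePoint.isOpenEmbedding_coe.isOpenMap.comp
            ((Homeomorph.mulLeft₀ y hyne).isOpenMap.comp Complex.isOpenMap_exp)
        have hg0 : g 0 = (y : Sphere) := by simp [g]
        have hgU : g ⁻¹' U ∈ 𝓝 (0 : ℂ) := hg.continuousAt (by rwa [hg0])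
        obtain ⟨δ, hδ, hb⟩ := Metric.mem_nhds_iff.1 hgU
        refine ⟨g '' Metric.ball 0 δ, ?_, image_subset_iff.2 hb, ?_⟩
        · rw [← hg0]
          exact hgo.image_mem_nhds (Metric.ball_mem_nhds _ hδ)
        · have : g '' Metric.ball 0 δ ∩ disc ∞ r =
              g '' (Metric.ball 0 δ ∩ {w | Real.log (r⁻¹ / ‖y‖) < w.re}) := by
            have hmem : ∀ w, g w ∈ disc ∞ r ↔ Real.log (r⁻¹ / ‖y‖) < w.re := by
              intro w
              have hyp := norm_pos_iff.2 hyne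
              rw [Real.log_lt_iff_lt_exp (by positivity), div_lt_iff₀ hyp, disc_infty, mem_compl_iff,
                OnePoint.coe_injective.mem_set_image, mem_closedBall_zero_iff, not_le, norm_mul,
                Complex.norm_exp, mul_comm]
            ext v
            constructor
            · rintro ⟨⟨w, hw, rfl⟩, h⟩
              exact ⟨w, ⟨hw, (hmem w).1 h⟩, rfl⟩
            · rintro ⟨w, ⟨hw, h⟩, rfl⟩
              exact ⟨⟨w, hw, rfl⟩, (hmem w).2 h⟩
          rw [this]
          exact ((convex_ball _ _).inter (convex_halfSpace_re_gt _)).isPreconnected.image _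
            hg.continuousOn

end Sphere

/-! ### N-surfaces, their logarithmic singularities and the involution -/

section Surface

variable {X : Type*} [TopologicalSpace X]

/-- Finitely many sets on which `p` is injective cover `K`, and each of them contains at most one
point over each point of `Q`. -/
theorem finite_inter_preimage_of_isCompact {Y : Type*} [TopologicalSpace Y] {p : X → Y}
    (hp : IsLocalHomeomorph p) {Q : Set Y} (hQ : Q.Finite) {K : Set X} (hK : IsCompact K) :
    (K ∩ p ⁻¹' Q).Finite := by
  choose U hU hinj using isLocallyInjective_iff_nhds.1 hp.isLocallyInjective
  obtain ⟨t, _, ht⟩ := hK.elim_nhds_subcover U fun x _ => hU x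
  refine (t.finite_toSet.biUnion (t := fun x => U x ∩ p ⁻¹' Q) fun x _ => ?_).subset ?_
  · refine Finite.of_finite_image (hQ.subset ?_) ((hinj x).mono inter_subset_left)
    rintro _ ⟨u, hu, rfl⟩
    exact hu.2
  · rintro u ⟨huK, huQ⟩
    obtain ⟨x, hx, hux⟩ := mem_iUnion₂.1 (ht huK)
    exact mem_iUnion₂.2 ⟨x, hx, hux, huQ⟩

variable {A : Set Sphere} {π : X → Sphere} {s : X → X} {D : DiscSystem A}

/-- The involution of a symmetric surface as a homeomorphism. -/
def IsSymmetricNSurface.involution (hX : IsSymmetricNSurface A π s) : X ≃ₜ X where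
  toFun := s
  invFun := s
  left_inv := hX.involutive
  right_inv := hX.involutive
  continuous_toFun := hX.continuous_inv
  continuous_invFun := hX.continuous_inv

theorem DiscSystem.eq_of_mem (D : DiscSystem A) {a b y : Sphere} (ha : a ∈ A) (hb : b ∈ A)
    (hya : y ∈ disc a (D.radius a)) (hyb : y ∈ disc b (D.radius b)) : a = b := by
  by_contra h
  exact disjoint_left.1 (D.disjoint ha hb h) hya hyb

theorem DiscSystem.self_mem (D : DiscSystem A) {a : Sphere} (ha : a ∈ A) :
    a ∈ disc a (D.radius a) := mem_disc_self a (D.radius_pos a ha)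

theorem DiscSystem.notMem_of_mem_diff (D : DiscSystem A) {a y : Sphere} (ha : a ∈ A)
    (hy : y ∈ disc a (D.radius a) \ {a}) : y ∉ A := fun h =>
  hy.2 (D.eq_of_mem h ha (D.self_mem h) hy.1)

theorem IsNSurface.locallySectioned_disc (hX : IsNSurface A π) (D : DiscSystem A) {a : Sphere}
    (ha : a ∈ A) : LocallySectioned π (disc a (D.radius a) \ {a}) :=
  hX.isCoveringMapOn.locallySectioned.mono fun _ hy => D.notMem_of_mem_diff ha hy

/-- The region of a logarithmic singularity is a component of the preimage of the full disc. -/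
theorem IsLogSingularity.isComponentOf_disc [T2Space X] (hX : IsNSurface A π) (D : DiscSystem A)
    {a : Sphere} (ha : a ∈ A) {V : Set X} (hV : IsLogSingularity π a (D.radius a) V) :
    IsComponentOf (π ⁻¹' disc a (D.radius a)) V := by
  obtain ⟨e, he, h0, hr⟩ := exists_disc_chart a (D.radius_pos a ha)
  have hls := hX.locallySectioned_disc D ha
  rw [← hr, ← h0] at hls
  obtain ⟨u, hu⟩ := hV.1.nonempty
  have huT : u ∈ π ⁻¹' disc a (D.radius a) := (hV.1.subset hu).1
  have hVF : V ⊆ connectedComponentIn (π ⁻¹' disc a (D.radius a)) u :=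
    hV.1.isPreconnected.subset_connectedComponentIn hu fun v hv => (hV.1.subset hv).1
  by_cases hx : ∃ x ∈ connectedComponentIn (π ⁻¹' disc a (D.radius a)) u, π x = a
  -- A point over the centre would make the component the image of a section, of degree one, against
  -- the infinite fibre.
  · exfalso
    obtain ⟨x, hxF, hxa⟩ := hx
    obtain ⟨σ, hσ, hσe, hσ0⟩ := exists_section_disc hX.isLocalHomeomorph he hls (hxa.trans h0.symm)
    have hF := connectedComponentIn_eq_range_section hX.isLocalHomeomorph he hσ hσe 0
    rw [hσ0, hr, ← connectedComponentIn_eq hxF] at hF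
    obtain ⟨y, _, hinf⟩ := hV.2
    apply hinf
    apply Subsingleton.finite
    rintro v ⟨hv, hvy⟩ v' ⟨hv', hvy'⟩
    obtain ⟨w, rfl⟩ := hF ▸ hVF hv
    obtain ⟨w', rfl⟩ := hF ▸ hVF hv'
    rw [mem_preimage, hσe, mem_singleton_iff] at hvy hvy'
    rw [he.injective (hvy.trans hvy'.symm)]
  · refine ⟨u, huT, hVF.antisymm ?_⟩
    rw [hV.1.eq_of_mem hu]
    refine isPreconnected_connectedComponentIn.subset_connectedComponentIn
      (mem_connectedComponentIn huT) fun x hxF => ⟨(isComponentOf_connectedComponentIn huT).subset hxF, ?_⟩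
    exact fun h => hx ⟨x, hxF, h⟩

/-- If there is a finite set with infinite preimage, then a component of the preimage of a disc that
does not define a logarithmic singularity is the image of a section. -/
theorem exists_isLogSingularity_or_section [T2Space X] (hX : IsNSurface A π) (D : DiscSystem A)
    (hinf : ∃ Q : Set Sphere, Q.Finite ∧ (π ⁻¹' Q).Infinite) {a : Sphere} (ha : a ∈ A)
    {e : ℂ → Sphere} (he : IsOpenEmbedding e) (h0 : e 0 = a)
    (hr : range e = disc a (D.radius a)) {x : X} (hx : π x ∈ disc a (D.radius a)) :
    (∃ V, IsLogSingularity π a (D.radius a) V ∧ x ∈ V) ∨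
      ∃ σ : ℂ → X, Continuous σ ∧ (∀ w, π (σ w) = e w) ∧ x ∈ range σ := by
  have hls := hX.locallySectioned_disc D ha
  rw [← hr, ← h0] at hls
  have hF : IsComponentOf (π ⁻¹' disc a (D.radius a))
    (connectedComponentIn (π ⁻¹' disc a (D.radius a)) x) := ⟨x, hx, rfl⟩
  set F := connectedComponentIn (π ⁻¹' disc a (D.radius a)) x with hFdef
  have hxF : x ∈ F := mem_connectedComponentIn hx
  by_cases hx' : ∃ x₀ ∈ F, π x₀ = a
  · right
    obtain ⟨x₀, hx₀F, hxa⟩ := hx'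
    obtain ⟨σ, hσ, hσe, hσ0⟩ := exists_section_disc hX.isLocalHomeomorph he hls (hxa.trans h0.symm)
    refine ⟨σ, hσ, hσe, ?_⟩
    have := connectedComponentIn_eq_range_section hX.isLocalHomeomorph he hσ hσe 0
    rw [hσ0, hr, ← connectedComponentIn_eq hx₀F] at this
    rwa [← this]
  · left
    push Not at hx'
    have hsub : F ⊆ π ⁻¹' (disc a (D.radius a) \ {a}) := fun u hu => ⟨hF.subset hu, hx' u hu⟩
    refine ⟨F, ⟨⟨x, hsub hxF, ?_⟩, ?_⟩, hxF⟩
    · refine (hF.isPreconnected.subset_connectedComponentIn hxF hsub).antisymm ?_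
      exact isPreconnected_connectedComponentIn.subset_connectedComponentIn
        (mem_connectedComponentIn (hsub hxF))
        ((connectedComponentIn_subset _ _).trans fun u hu => hu.1)
    · by_contra hfin
      push Not at hfin
      obtain ⟨Q, hQ, hQinf⟩ := hinf
      -- With all fibres finite, the part of `F` over a smaller disc is a neighbourhood of infinity.
      -- The radius is chosen so that this disc contains no point of `Q` except possibly `a`, which
      -- `F` omits; hence all of `π ⁻¹' Q` lies in a compact set.
      obtain ⟨ρ, hρ, hball⟩ : ∃ ρ > 0, Metric.ball (0 : ℂ) ρ ⊆ (e ⁻¹' (Q \ {a}))ᶜ := by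
        refine Metric.isOpen_iff.1 ?_ 0 ?_
        · exact (((hQ.subset sdiff_subset).isClosed).preimage he.continuous).isOpen_compl
        · simp [h0]
      obtain ⟨φ⟩ := hX.plane
      obtain ⟨K, hK, hKc⟩ := exists_isCompact_compl_subset hX.isLocalHomeomorph φ.symm he hls
        (by rwa [hr]) (by rwa [h0]) (half_pos hρ) (F := F) (by
          refine hfin (e (ρ / 2 : ℝ)) ⟨hr ▸ mem_range_self _, fun h => ?_⟩
          rw [mem_singleton_iff, ← h0] at h
          have := he.injective h
          rw [Complex.ofReal_eq_zero] at this
          linarith)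
      refine hQinf ((finite_inter_preimage_of_isCompact hX.isLocalHomeomorph hQ hK).subset
        fun u hu => ⟨?_, hu⟩)
      by_contra huK
      obtain ⟨huF, w, hw, hwu⟩ := hKc huK
      refine hball (Metric.ball_subset_ball (by linarith) hw) ⟨hwu ▸ hu, ?_⟩
      rw [hwu]
      exact hx' u huF

/-- The involution permutes the logarithmic singularities over a real point. -/
theorem IsLogSingularity.image_involution (hX : IsSymmetricNSurface A π s) {a : Sphere} {r : ℝ}
    (ha : conj a = a) {V : Set X} (hV : IsLogSingularity π a r V) :
    IsLogSingularity π a r (s '' V) := by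
  have hT : s '' (π ⁻¹' (disc a r \ {a})) = π ⁻¹' (disc a r \ {a}) := by
    have : ∀ x ∈ π ⁻¹' (disc a r \ {a}), s x ∈ π ⁻¹' (disc a r \ {a}) := by
      intro x hx
      rw [mem_preimage, hX.map_inv]
      refine ⟨conj_mem_disc ha hx.1, fun h => hx.2 ?_⟩
      rw [mem_singleton_iff] at h ⊢
      rw [← conj_conj (π x), h, ha]
    apply Subset.antisymm
    · rintro _ ⟨x, hx, rfl⟩
      exact this x hx
    · intro x hx
      exact ⟨s x, this x hx, hX.involutive x⟩
  obtain ⟨h1, y, hy, hinf⟩ := hV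
  refine ⟨?_, conj y, ?_, ?_⟩
  · have := h1.image_homeomorph hX.involution
    rwa [show ⇑hX.involution = s from rfl, hT] at this
  · refine ⟨conj_mem_disc ha hy.1, fun h => hy.2 ?_⟩
    rw [mem_singleton_iff] at h ⊢
    rw [← conj_conj y, h, ha]
  · refine (hinf.image hX.involutive.injective.injOn).mono ?_
    rintro _ ⟨x, ⟨hx, hxy⟩, rfl⟩
    refine ⟨mem_image_of_mem _ hx, ?_⟩
    rw [mem_preimage, hX.map_inv, show π x = y from hxy]
    rfl

variable {φ : ℂ ≃ₜ X}

theorem mem_axis_iff (hφ : ∀ z, φ (starRingEnd ℂ z) = s (φ z)) (z : ℂ) :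
    φ z ∈ axis s ↔ z.im = 0 := by
  rw [axis, mem_ofPred_eq, ← hφ, φ.injective.eq_iff, Complex.conj_eq_iff_im]

/-- The halfplanes of a symmetric surface. -/
theorem image_upper_or_lower (hφ : ∀ z, φ (starRingEnd ℂ z) = s (φ z)) {H : Set X}
    (hH : IsComponentOf (axis s)ᶜ H) :
    H = φ '' {z | 0 < z.im} ∧ s '' H = φ '' {z | z.im < 0} ∨
      H = φ '' {z | z.im < 0} ∧ s '' H = φ '' {z | 0 < z.im} := by
  have hU : IsOpen (φ '' {z | 0 < z.im}) :=
    φ.isOpenMap _ (isOpen_lt continuous_const Complex.continuous_im)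
  have hL : IsOpen (φ '' {z | z.im < 0}) :=
    φ.isOpenMap _ (isOpen_lt Complex.continuous_im continuous_const)
  have hUc : IsPreconnected (φ '' {z | 0 < z.im}) :=
    (convex_halfSpace_im_gt 0).isPreconnected.image _ φ.continuous.continuousOn
  have hLc : IsPreconnected (φ '' {z | z.im < 0}) :=
    (convex_halfSpace_im_lt 0).isPreconnected.image _ φ.continuous.continuousOn
  have hd : Disjoint (φ '' {z | 0 < z.im}) (φ '' {z | z.im < 0}) := by
    rw [disjoint_left]
    rintro _ ⟨z, hz, rfl⟩ ⟨w, hw, hwz⟩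
    rw [φ.injective hwz] at hw
    exact lt_asymm (show 0 < z.im from hz) hw
  have hcov : ∀ x ∈ (axis s)ᶜ, x ∈ φ '' {z | 0 < z.im} ∨ x ∈ φ '' {z | z.im < 0} := by
    intro x hx
    obtain ⟨z, rfl⟩ := φ.surjective x
    rw [mem_compl_iff, mem_axis_iff hφ] at hx
    rcases lt_or_gt_of_ne hx with h | h
    · exact Or.inr ⟨z, h, rfl⟩
    · exact Or.inl ⟨z, h, rfl⟩
  have hUs : φ '' {z | 0 < z.im} ⊆ (axis s)ᶜ := by
    rintro _ ⟨z, hz, rfl⟩ h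
    exact (ne_of_gt hz) ((mem_axis_iff hφ z).1 h)
  have hLs : φ '' {z | z.im < 0} ⊆ (axis s)ᶜ := by
    rintro _ ⟨z, hz, rfl⟩ h
    exact (ne_of_lt hz) ((mem_axis_iff hφ z).1 h)
  have hsU : s '' (φ '' {z | 0 < z.im}) = φ '' {z | z.im < 0} := by
    ext x
    constructor
    · rintro ⟨_, ⟨z, hz, rfl⟩, rfl⟩
      exact ⟨starRingEnd ℂ z, by simpa using hz, hφ z⟩
    · rintro ⟨z, hz, rfl⟩
      refine ⟨_, ⟨starRingEnd ℂ z, by simpa using hz, rfl⟩, ?_⟩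
      rw [← hφ, Complex.conj_conj]
  have hsL : s '' (φ '' {z | z.im < 0}) = φ '' {z | 0 < z.im} := by
    ext x
    constructor
    · rintro ⟨_, ⟨z, hz, rfl⟩, rfl⟩
      exact ⟨starRingEnd ℂ z, by simpa using hz, hφ z⟩
    · rintro ⟨z, hz, rfl⟩
      refine ⟨_, ⟨starRingEnd ℂ z, by simpa using hz, rfl⟩, ?_⟩
      rw [← hφ, Complex.conj_conj]
  have hcl : ∀ {P P' : Set X}, IsOpen P' → Disjoint P P' → (∀ x ∈ (axis s)ᶜ, x ∈ P ∨ x ∈ P') →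
      closure P ∩ (axis s)ᶜ ⊆ P := fun hP' hPP' hc x hx =>
    (hc x hx.2).resolve_right fun h => disjoint_left.1 (hPP'.closure_left hP') hx.1 h
  obtain ⟨x, hx⟩ := hH.nonempty
  rcases hcov x (hH.subset hx) with h | h
  · left
    have : H = φ '' {z | 0 < z.im} := by
      rw [hH.eq_of_mem hx]
      exact connectedComponentIn_eq_of_isOpen hUc hU h hUs (hcl hL hd hcov)
    exact ⟨this, this ▸ hsU⟩
  · right
    have : H = φ '' {z | z.im < 0} := by
      rw [hH.eq_of_mem hx]
      exact connectedComponentIn_eq_of_isOpen hLc hL h hLs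
        (hcl hU hd.symm fun x hx => (hcov x hx).symm)
    exact ⟨this, this ▸ hsL⟩

theorem subset_half_or_subset_image (hφ : ∀ z, φ (starRingEnd ℂ z) = s (φ z)) {H V : Set X}
    (hH : IsComponentOf (axis s)ᶜ H) (hV : IsPreconnected V) (hVs : V ⊆ (axis s)ᶜ) :
    V ⊆ H ∨ V ⊆ s '' H := by
  rcases V.eq_empty_or_nonempty with rfl | ⟨x, hx⟩
  · exact Or.inl (empty_subset _)
  have h1 := image_upper_or_lower hφ (isComponentOf_connectedComponentIn (hVs hx))
  have h2 := hV.subset_connectedComponentIn hx hVs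
  rcases image_upper_or_lower hφ hH with h | h <;> rcases h1 with h' | h'
  · left; rw [h.1, ← h'.1]; exact h2
  · right; rw [h.2, ← h'.1]; exact h2
  · right; rw [h.2, ← h'.1]; exact h2
  · left; rw [h.1, ← h'.1]; exact h2

/-- A logarithmic singularity over a moved point lies in one of the two halfplanes. -/
theorem Deformation.subset_half_or (hX : IsSymmetricNSurface A π s)
    (hφ : ∀ z, φ (starRingEnd ℂ z) = s (φ z)) (E : Deformation π s D) {a : Sphere}
    (ha : a ∈ E.moved) {V : Set X} (hV : IsLogSingularity π a (D.radius a) V) :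
    V ⊆ E.half ∨ V ⊆ s '' E.half := by
  refine subset_half_or_subset_image hφ E.half_spec hV.1.isPreconnected fun v hv hvs => ?_
  -- If `V` met the axis, then `V` and `s '' V` would share a fixed point and hence be equal. This
  -- would be a real singularity over a moved point.
  have hVs := IsLogSingularity.image_involution hX (E.moved_subset ha).2 hV
  refine E.not_real (a, V) ⟨E.moved_subset ha, hV, ?_⟩ ha
  exact hVs.1.eq_of_mem_of_mem hV.1 (x := v) ⟨v, hv, hvs⟩ hv

theorem Deformation.moved_subset_base (E : Deformation π s D) : E.moved ⊆ A := fun _ h =>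
  (E.moved_subset h).1

/-- The deformed map is symmetric. -/
theorem Deformation.map_involution (hX : IsSymmetricNSurface A π s)
    (hφ : ∀ z, φ (starRingEnd ℂ z) = s (φ z)) (E : Deformation π s D) (x : X) :
    E.map (s x) = conj (E.map x) := by
  by_cases h : ∃ a ∈ E.moved, ∃ V, IsLogSingularity π a (D.radius a) V ∧ x ∈ V
  · obtain ⟨a, ha, V, hV, hx⟩ := h
    have hVs := IsLogSingularity.image_involution hX (E.moved_subset ha).2 hV
    have hsx : s x ∈ s '' V := mem_image_of_mem _ hx
    rcases E.subset_half_or hX hφ ha hV with h | h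
    · rw [E.map_plus a ha V hV h x hx, E.map_minus a ha _ hVs (image_mono h) _ hsx, hX.map_inv,
        conj_conj]
    · have h' : s '' V ⊆ E.half := by
        rintro _ ⟨v, hv, rfl⟩
        obtain ⟨u, hu, rfl⟩ := h hv
        rwa [hX.involutive]
      rw [E.map_minus a ha V hV h x hx, E.map_plus a ha _ hVs h' _ hsx, hX.map_inv, conj_conj]
  · push Not at h
    rw [E.map_otherwise x h, E.map_otherwise (s x), hX.map_inv]
    intro a ha V hV hx
    refine h a ha _ (IsLogSingularity.image_involution hX (E.moved_subset ha).2 hV) ?_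
    exact ⟨s x, hx, hX.involutive x⟩

end Surface

/-! ### The deformed map: local homeomorphism and local sections -/

section Deformation

variable {X : Type*} [TopologicalSpace X] {A : Set Sphere} {π : X → Sphere} {s : X → X}
  {D : DiscSystem A} {φ : ℂ ≃ₜ X}

namespace Deformation

/-- The homeomorphism that describes the deformation in the second halfplane. -/
def ηConj (E : Deformation π s D) (a : Sphere) : Sphere ≃ₜ Sphere :=
  (conjHomeo.trans (E.η a)).trans conjHomeo

theorem ηConj_apply (E : Deformation π s D) (a y : Sphere) :
    E.ηConj a y = conj (E.η a (conj y)) := rfl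

/-- The homeomorphisms that relate the deformed map to the original one over the disc about `a`. -/
def models (E : Deformation π s D) (a : Sphere) : Set (Sphere ≃ₜ Sphere) :=
  {Homeomorph.refl Sphere, E.η a, E.ηConj a}

theorem finite_models (E : Deformation π s D) (a : Sphere) : (E.models a).Finite := by
  simp [models]

theorem models_off (E : Deformation π s D) {a : Sphere} (ha : a ∈ E.moved) {χ : Sphere ≃ₜ Sphere}
    (hχ : χ ∈ E.models a) {y : Sphere} (hy : y ∉ disc a (D.radius a)) : χ y = y := by
  have hreal := (E.moved_subset ha).2
  rcases hχ with rfl | rfl | rfl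
  · rfl
  · exact E.η_off a ha y hy
  · rw [ηConj_apply, E.η_off a ha, conj_conj]
    intro h
    exact hy (conj_conj y ▸ conj_mem_disc hreal h)

/-- A bijection that is the identity off the disc preserves the disc. -/
theorem models_mem_disc (E : Deformation π s D) {a : Sphere} (ha : a ∈ E.moved)
    {χ : Sphere ≃ₜ Sphere} (hχ : χ ∈ E.models a) {y : Sphere} :
    χ y ∈ disc a (D.radius a) ↔ y ∈ disc a (D.radius a) := by
  constructor
  · intro h
    by_contra hy
    rw [E.models_off ha hχ hy] at h
    exact hy h
  · intro h
    by_contra hy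
    have := χ.injective (E.models_off ha hχ hy)
    rw [this] at hy
    exact hy h

theorem models_base (E : Deformation π s D) {a : Sphere} (ha : a ∈ E.moved) {χ : Sphere ≃ₜ Sphere}
    (hχ : χ = E.η a ∨ χ = E.ηConj a) : χ a ∈ E.base := by
  refine Or.inr ⟨a, ha, ?_⟩
  rcases hχ with rfl | rfl
  · exact Or.inl (E.η_base a ha)
  · right
    rw [ηConj_apply, (E.moved_subset ha).2, E.η_base a ha]

theorem finite_moved (hX : IsNSurface A π) (E : Deformation π s D) : E.moved.Finite :=
  hX.finite_base.subset E.moved_subset_base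

/-- The deformed map on a logarithmic singularity over a moved point. -/
theorem exists_model_of_isLogSingularity (hX : IsSymmetricNSurface A π s)
    (hφ : ∀ z, φ (starRingEnd ℂ z) = s (φ z)) (E : Deformation π s D) {a : Sphere}
    (ha : a ∈ E.moved) {V : Set X} (hV : IsLogSingularity π a (D.radius a) V) :
    ∃ χ, (χ = E.η a ∨ χ = E.ηConj a) ∧ ∀ x ∈ V, E.map x = χ (π x) := by
  rcases E.subset_half_or hX hφ ha hV with h | h
  · exact ⟨_, Or.inl rfl, E.map_plus a ha V hV h⟩
  · exact ⟨_, Or.inr rfl, E.map_minus a ha V hV h⟩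

theorem map_eq_of_forall_notMem (E : Deformation π s D) {a : Sphere} (ha : a ∈ A) {x : X}
    (hx : π x ∈ disc a (D.radius a))
    (h : ∀ V, IsLogSingularity π a (D.radius a) V → x ∉ V) : E.map x = π x := by
  refine E.map_otherwise x fun b hb V hV hxV => ?_
  have hab : b = a := D.eq_of_mem (E.moved_subset_base hb) ha (hV.1.subset hxV).1 hx
  subst hab
  exact h V hV hxV

/-- The deformed map over the disc about a moved point. -/
theorem exists_model [T2Space X] (hX : IsSymmetricNSurface A π s)
    (hφ : ∀ z, φ (starRingEnd ℂ z) = s (φ z)) (E : Deformation π s D) {a : Sphere}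
    (ha : a ∈ E.moved) {C : Set X} (hC : IsPreconnected C) (hCa : C ⊆ π ⁻¹' disc a (D.radius a)) :
    ∃ χ ∈ E.models a, ∀ x ∈ C, E.map x = χ (π x) := by
  have haA := E.moved_subset_base ha
  by_cases h : ∃ V, IsLogSingularity π a (D.radius a) V ∧ ∃ x ∈ C, x ∈ V
  · obtain ⟨V, hV, x, hxC, hxV⟩ := h
    have hCV := (IsLogSingularity.isComponentOf_disc hX.toIsNSurface D haA hV).subset_of_isPreconnected
      hC hCa hxC hxV
    obtain ⟨χ, hχ, hmap⟩ := E.exists_model_of_isLogSingularity hX hφ ha hV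
    exact ⟨χ, Or.inr hχ, fun x hx => hmap x (hCV hx)⟩
  · push Not at h
    exact ⟨_, Or.inl rfl, fun x hx => E.map_eq_of_forall_notMem haA (hCa hx)
      fun V hV => h V hV x hx⟩

theorem map_eq_of_notMem_disc (E : Deformation π s D) {x : X}
    (hx : ∀ a ∈ E.moved, π x ∉ disc a (D.radius a)) : E.map x = π x :=
  E.map_otherwise x fun a ha _ hV hxV => hx a ha (hV.1.subset hxV).1

/-- The models over different discs may be combined. -/
theorem exists_global_model (hX : IsNSurface A π) (E : Deformation π s D)
    {c : Sphere → Sphere ≃ₜ Sphere} (hc : ∀ a ∈ E.moved, c a ∈ E.models a) :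
    ∃ ψ : Sphere ≃ₜ Sphere, (∀ a ∈ E.moved, ∀ y ∈ disc a (D.radius a), ψ y = c a y) ∧
      ∀ y, (∀ a ∈ E.moved, y ∉ disc a (D.radius a)) → ψ y = y := by
  suffices H : ∀ T : Set Sphere, T.Finite → T ⊆ E.moved → ∃ ψ : Sphere ≃ₜ Sphere,
      (∀ a ∈ T, ∀ y ∈ disc a (D.radius a), ψ y = c a y) ∧
      ∀ y, (∀ a ∈ T, y ∉ disc a (D.radius a)) → ψ y = y from
    H _ (E.finite_moved hX) Subset.rfl
  intro T hT
  induction T, hT using Set.Finite.induction_on with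
  | empty => exact fun _ => ⟨Homeomorph.refl _, by simp, fun _ _ => rfl⟩
  | @insert b T hb _ ih =>
    intro hsub
    obtain ⟨ψ, h1, h2⟩ := ih ((subset_insert _ _).trans hsub)
    have hbm := hsub (mem_insert _ _)
    -- Each factor preserves its own disc and is the identity outside it. As the discs are disjoint,
    -- at most one factor acts on a given point.
    refine ⟨(c b).trans ψ, ?_, ?_⟩
    · rintro a ha y hy
      rw [Homeomorph.trans_apply]
      by_cases hab : a = b
      · subst hab
        apply h2
        intro a' ha' hmem
        have := (E.models_mem_disc hbm (hc _ hbm)).2 hy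
        have := D.eq_of_mem (E.moved_subset_base (hsub (mem_insert_of_mem _ ha')))
          (E.moved_subset_base hbm) hmem this
        exact hb (this ▸ ha')
      · have haT : a ∈ T := ha.resolve_left hab
        rw [E.models_off hbm (hc b hbm), h1 a haT y hy]
        exact fun h => hab (D.eq_of_mem (E.moved_subset_base (hsub ha))
          (E.moved_subset_base hbm) hy h)
    · intro y hy
      rw [Homeomorph.trans_apply, E.models_off hbm (hc b hbm) (hy b (mem_insert _ _))]
      exact h2 y fun a ha => hy a (mem_insert_of_mem _ ha)

/-- The deformed map along a section of the original one. -/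
theorem exists_global_model_section [T2Space X] (hX : IsSymmetricNSurface A π s)
    (hφ : ∀ z, φ (starRingEnd ℂ z) = s (φ z)) (E : Deformation π s D) {U : Set Sphere}
    {W : Sphere → Set Sphere} (hW : ∀ a ∈ E.moved, W a ⊆ U)
    (hWc : ∀ a ∈ E.moved, IsPreconnected (W a ∩ disc a (D.radius a))) {σ : Sphere → X}
    (hσ : ContinuousOn σ U) (hσU : ∀ z ∈ U, π (σ z) = z) :
    ∃ ψ : Sphere ≃ₜ Sphere, (∃ c : Sphere → Sphere ≃ₜ Sphere, (∀ a ∈ E.moved, c a ∈ E.models a) ∧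
      ∀ a ∈ E.moved, ∀ y ∈ disc a (D.radius a), ψ y = c a y) ∧
      (∀ y, (∀ a ∈ E.moved, y ∉ disc a (D.radius a)) → ψ y = y) ∧
      ∀ z ∈ U, (∀ a ∈ E.moved, z ∈ disc a (D.radius a) → z ∈ W a) → E.map (σ z) = ψ z := by
  have h : ∀ a, ∃ χ : Sphere ≃ₜ Sphere, a ∈ E.moved → χ ∈ E.models a ∧
      ∀ x ∈ σ '' (W a ∩ disc a (D.radius a)), E.map x = χ (π x) := by
    intro a
    by_cases ha : a ∈ E.moved
    · obtain ⟨χ, h1, h2⟩ := E.exists_model hX hφ ha ((hWc a ha).image σ (hσ.mono fun z hz =>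
        hW a ha hz.1)) (by
          rintro _ ⟨z, hz, rfl⟩
          rw [mem_preimage, hσU z (hW a ha hz.1)]
          exact hz.2)
      exact ⟨χ, fun _ => ⟨h1, h2⟩⟩
    · exact ⟨Homeomorph.refl _, fun h => absurd h ha⟩
  choose c hc using h
  obtain ⟨ψ, hψ, hψ'⟩ := E.exists_global_model hX.toIsNSurface fun a ha => (hc a ha).1
  refine ⟨ψ, ⟨c, fun a ha => (hc a ha).1, hψ⟩, hψ', fun z hz hzW => ?_⟩
  by_cases h : ∃ a ∈ E.moved, z ∈ disc a (D.radius a)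
  · obtain ⟨a, ha, hza⟩ := h
    rw [hψ a ha z hza, (hc a ha).2 _ (mem_image_of_mem _ ⟨hzW a ha hza, hza⟩), hσU z hz]
  · push Not at h
    rw [hψ' z h, E.map_eq_of_notMem_disc (by rwa [hσU z hz]), hσU z hz]

/-- Several closed discs may meet at `y`, so each moved point gets its own neighbourhood. Because
the trace on the disc is connected, a section sends it into a single component over that disc, on
which a single model describes the deformed map. -/
theorem exists_boundary_nhds (E : Deformation π s D) {y : Sphere}
    (hy : ∀ a ∈ E.moved, y ∉ disc a (D.radius a)) {U : Set Sphere} (hU : U ∈ 𝓝 y) :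
    ∃ W : Sphere → Set Sphere, (∀ a ∈ E.moved, W a ∈ 𝓝 y) ∧ (∀ a ∈ E.moved, W a ⊆ U) ∧
      ∀ a ∈ E.moved, IsPreconnected (W a ∩ disc a (D.radius a)) := by
  have h : ∀ a, ∃ W : Set Sphere, a ∈ E.moved → W ∈ 𝓝 y ∧ W ⊆ U ∧
      IsPreconnected (W ∩ disc a (D.radius a)) := by
    intro a
    by_cases ha : a ∈ E.moved
    · obtain ⟨W, h⟩ := exists_isPreconnected_inter_disc
        (D.radius_pos a (E.moved_subset_base ha)) (hy a ha) hU
      exact ⟨W, fun _ => h⟩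
    · exact ⟨∅, fun h => absurd h ha⟩
  choose W hW using h
  exact ⟨W, fun a ha => (hW a ha).1, fun a ha => (hW a ha).2.1, fun a ha => (hW a ha).2.2⟩

theorem isLocalHomeomorph_of_eventuallyEq {p q : X → Sphere} (hp : IsLocalHomeomorph p)
    (h : ∀ x, ∃ ψ : Sphere ≃ₜ Sphere, ∀ᶠ u in 𝓝 x, q u = ψ (p u)) : IsLocalHomeomorph q := by
  refine IsLocalHomeomorph.mk q fun x => ?_
  obtain ⟨ψ, hψ⟩ := h x
  obtain ⟨e, hxe, rfl⟩ := hp x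
  obtain ⟨W, hW, hWo, hxW⟩ := mem_nhds_iff.1 hψ
  refine ⟨(e.restrOpen W hWo).trans ψ.toOpenPartialHomeomorph, by simp [hxe, hxW], fun u hu => ?_⟩
  simp only [OpenPartialHomeomorph.trans_source, OpenPartialHomeomorph.restrOpen_source,
    Homeomorph.toOpenPartialHomeomorph_source, preimage_univ, inter_univ] at hu
  simpa using hW hu.2

/-- The deformed map is a local homeomorphism. -/
theorem isLocalHomeomorph_map [T2Space X] [LocallyConnectedSpace X]
    (hX : IsSymmetricNSurface A π s) (hφ : ∀ z, φ (starRingEnd ℂ z) = s (φ z))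
    (E : Deformation π s D) : IsLocalHomeomorph E.map := by
  refine isLocalHomeomorph_of_eventuallyEq hX.isLocalHomeomorph fun x => ?_
  by_cases h : ∃ a ∈ E.moved, π x ∈ disc a (D.radius a)
  · obtain ⟨a, ha, hxa⟩ := h
    have hF := isComponentOf_connectedComponentIn (T := π ⁻¹' disc a (D.radius a)) hxa
    obtain ⟨χ, _, hχ⟩ := E.exists_model hX hφ ha hF.isPreconnected hF.subset
    refine ⟨χ, Filter.mem_of_superset (IsOpen.mem_nhds (hF.isOpen ((isOpen_disc _ _).preimage
      hX.isLocalHomeomorph.continuous)) (mem_connectedComponentIn hxa)) hχ⟩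
  · push Not at h
    obtain ⟨q, hxq, hq⟩ := hX.isLocalHomeomorph x
    have hU : q.target ∈ 𝓝 (π x) := by
      rw [hq]
      exact q.open_target.mem_nhds (q.map_source hxq)
    obtain ⟨W, hW, hWU, hWc⟩ := E.exists_boundary_nhds h hU
    obtain ⟨ψ, _, _, hψ⟩ := E.exists_global_model_section hX hφ hWU hWc q.continuousOn_symm
      fun z hz => by rw [hq]; exact q.right_inv hz
    refine ⟨ψ, ?_⟩
    have hcont := hX.isLocalHomeomorph.continuous.tendsto x
    have hall : ∀ᶠ u in 𝓝 x, ∀ a ∈ E.moved, π u ∈ W a := by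
      rw [Filter.eventually_all_finite (E.finite_moved hX.toIsNSurface)]
      exact fun a ha => hcont (hW a ha)
    filter_upwards [hall, q.open_source.mem_nhds hxq] with u hu huq
    have := hψ (π u) (by rw [hq]; exact q.map_source huq) fun a ha _ => hu a ha
    have hleft : q.symm (π u) = u := by
      rw [hq]
      exact q.left_inv huq
    rwa [hleft] at this

/-- The deformed map has local sections near the points outside the discs. -/
theorem exists_hasSectionsOver_of_notMem_disc [T2Space X] (hX : IsSymmetricNSurface A π s)
    (hφ : ∀ z, φ (starRingEnd ℂ z) = s (φ z)) (E : Deformation π s D) {y : Sphere}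
    (hy : ∀ a ∈ E.moved, y ∉ disc a (D.radius a)) (hyA : y ∉ A) :
    ∃ N ∈ 𝓝 y, HasSectionsOver E.map N := by
  obtain ⟨U, hU, hUs⟩ := hX.isCoveringMapOn.locallySectioned y hyA
  obtain ⟨W, hW, hWU, hWc⟩ := E.exists_boundary_nhds hy hU
  have hfin := E.finite_moved hX.toIsNSurface
  -- Which model acts depends on the sheet. Intersecting over all of them ensures that the
  -- undeformed point lies in `W a` whichever model applies.
  refine ⟨U ∩ ⋂ a ∈ E.moved, ⋂ χ ∈ E.models a, χ '' W a, Filter.inter_mem hU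
    ((Filter.biInter_mem hfin).2 fun a ha => (Filter.biInter_mem (E.finite_models a)).2
      fun χ hχ => ?_), ?_⟩
  · have := χ.isOpenMap.image_mem_nhds (hW a ha)
    rwa [E.models_off ha hχ (hy a ha)] at this
  · intro x hx
    have key : ∀ a ∈ E.moved, ∀ χ ∈ E.models a, ∀ w,
        χ w ∈ U ∩ ⋂ a ∈ E.moved, ⋂ χ ∈ E.models a, χ '' W a → w ∈ W a := by
      intro a ha χ hχ w hw
      have := mem_iInter₂.1 (mem_iInter₂.1 hw.2 a ha) χ hχ
      rwa [χ.injective.mem_set_image] at this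
    have hπx : π x ∈ U ∧ ∀ a ∈ E.moved, π x ∈ disc a (D.radius a) → π x ∈ W a := by
      have hWx : ∀ a ∈ E.moved, π x ∈ disc a (D.radius a) → π x ∈ W a := by
        intro a ha hxa
        obtain ⟨χ, hχ, hmap⟩ := E.exists_model hX hφ ha (isPreconnected_singleton (x := x))
          (singleton_subset_iff.2 hxa)
        exact key a ha χ hχ _ (hmap x rfl ▸ hx)
      refine ⟨?_, hWx⟩
      by_cases h : ∃ a ∈ E.moved, π x ∈ disc a (D.radius a)
      · obtain ⟨a, ha, hxa⟩ := h
        exact hWU a ha (hWx a ha hxa)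
      · push Not at h
        rw [← E.map_eq_of_notMem_disc h]
        exact hx.1
    obtain ⟨σ, hσ, hσU, hσx⟩ := hUs x hπx.1
    obtain ⟨ψ, ⟨c, hc, hψc⟩, hψ', hψ⟩ := E.exists_global_model_section hX hφ hWU hWc hσ hσU
    have hpre : ∀ w, ψ w ∈ U ∩ ⋂ a ∈ E.moved, ⋂ χ ∈ E.models a, χ '' W a →
        w ∈ U ∧ ∀ a ∈ E.moved, w ∈ disc a (D.radius a) → w ∈ W a := by
      intro w hw
      have hWw : ∀ a ∈ E.moved, w ∈ disc a (D.radius a) → w ∈ W a := fun a ha hwa =>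
        key a ha (c a) (hc a ha) w (hψc a ha w hwa ▸ hw)
      refine ⟨?_, hWw⟩
      by_cases h : ∃ a ∈ E.moved, w ∈ disc a (D.radius a)
      · obtain ⟨a, ha, hxa⟩ := h
        exact hWU a ha (hWw a ha hxa)
      · push Not at h
        rw [← hψ' w h]
        exact hw.1
    refine ⟨fun z => σ (ψ.symm z), hσ.comp ψ.symm.continuous.continuousOn fun z hz =>
      (hpre _ (by rwa [ψ.apply_symm_apply])).1, fun z hz => ?_, ?_⟩
    · have := hpre (ψ.symm z) (by rwa [ψ.apply_symm_apply])
      rw [hψ _ this.1 this.2, ψ.apply_symm_apply]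
    · have := hψ _ hπx.1 hπx.2
      rw [hσx] at this
      simp [this, hσx]

/-- The deformed map has local sections near the points of the discs about the moved points. -/
theorem exists_hasSectionsOver_of_mem_disc [T2Space X] (hX : IsSymmetricNSurface A π s)
    (hφ : ∀ z, φ (starRingEnd ℂ z) = s (φ z)) (E : Deformation π s D)
    (hinf : ∃ Q : Set Sphere, Q.Finite ∧ (π ⁻¹' Q).Infinite) {a : Sphere} (ha : a ∈ E.moved)
    {y : Sphere} (hy : y ∈ disc a (D.radius a)) (hyb : y ∉ E.base) :
    ∃ N ∈ 𝓝 y, HasSectionsOver E.map N := by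
  have haA := E.moved_subset_base ha
  obtain ⟨e, he, h0, hr⟩ := exists_disc_chart a (D.radius_pos a haA)
  -- On a logarithmic singularity sections of `π` are needed near `χ.symm y`. This point is not `a`,
  -- because `χ a` is a new base point and `y` is not.
  have hloc : ∀ χ : Sphere ≃ₜ Sphere, χ = E.η a ∨ χ = E.ηConj a →
      ∃ N ∈ 𝓝 (χ.symm y), N ⊆ disc a (D.radius a) \ {a} ∧ IsPreconnected N ∧
        HasSectionsOver π N := by
    intro χ hχ
    have h1 : χ.symm y ∈ disc a (D.radius a) := by
      rw [← E.models_mem_disc ha (Or.inr hχ), χ.apply_symm_apply]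
      exact hy
    have h2 : χ.symm y ≠ a := by
      intro h
      apply hyb
      rw [← χ.apply_symm_apply y, h]
      exact E.models_base ha hχ
    obtain ⟨w, hw⟩ := hr ▸ h1
    obtain ⟨N, hN, hNs⟩ := hX.toIsNSurface.locallySectioned_disc D haA _ ⟨h1, h2⟩
    have h3 : e ⁻¹' (N ∩ {a}ᶜ) ∈ 𝓝 w := he.continuous.continuousAt (by
      rw [hw]
      exact Filter.inter_mem hN (isOpen_compl_singleton.mem_nhds h2))
    obtain ⟨δ, hδ, hb⟩ := Metric.mem_nhds_iff.1 h3
    refine ⟨e '' Metric.ball w δ, ?_, ?_, ?_, ?_⟩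
    · rw [← hw]
      exact he.isOpenMap.image_mem_nhds (Metric.ball_mem_nhds _ hδ)
    · rintro _ ⟨v, hv, rfl⟩
      exact ⟨hr ▸ mem_range_self _, (hb hv).2⟩
    · exact (convex_ball _ _).isPreconnected.image _ he.continuous.continuousOn
    · refine hNs.mono ?_
      rintro _ ⟨v, hv, rfl⟩
      exact (hb hv).1
  obtain ⟨N₁, hN₁⟩ := hloc _ (Or.inl rfl)
  obtain ⟨N₂, hN₂⟩ := hloc _ (Or.inr rfl)
  have himg : ∀ (χ : Sphere ≃ₜ Sphere) {N : Set Sphere}, N ∈ 𝓝 (χ.symm y) → χ '' N ∈ 𝓝 y := by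
    intro χ N hN
    have := χ.isOpenMap.image_mem_nhds hN
    rwa [χ.apply_symm_apply] at this
  refine ⟨disc a (D.radius a) ∩ (E.η a '' N₁ ∩ E.ηConj a '' N₂), Filter.inter_mem
    ((isOpen_disc _ _).mem_nhds hy) (Filter.inter_mem (himg _ hN₁.1) (himg _ hN₂.1)), ?_⟩
  intro x hx
  have hπx : π x ∈ disc a (D.radius a) := by
    by_cases h : ∃ b ∈ E.moved, π x ∈ disc b (D.radius b)
    · obtain ⟨b, hb, hxb⟩ := h
      obtain ⟨χ, hχ, hmap⟩ := E.exists_model hX hφ hb (isPreconnected_singleton (x := x))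
          (singleton_subset_iff.2 hxb)
      have := (E.models_mem_disc hb hχ).2 hxb
      rw [← hmap x rfl] at this
      rwa [D.eq_of_mem haA (E.moved_subset_base hb) hx.1 this]
    · push Not at h
      have := hx.1
      rwa [E.map_eq_of_notMem_disc h] at this
  by_cases hlog : ∃ V, IsLogSingularity π a (D.radius a) V ∧ x ∈ V
  · obtain ⟨V, hV, hxV⟩ := hlog
    obtain ⟨χ, hχ, hmap⟩ := E.exists_model_of_isLogSingularity hX hφ ha hV
    obtain ⟨N, ⟨-, hNa, hNc, hNs⟩, hNχ⟩ : ∃ N, (N ∈ 𝓝 (χ.symm y) ∧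
        N ⊆ disc a (D.radius a) \ {a} ∧ IsPreconnected N ∧ HasSectionsOver π N) ∧
        disc a (D.radius a) ∩ (E.η a '' N₁ ∩ E.ηConj a '' N₂) ⊆ χ '' N := by
      rcases hχ with rfl | rfl
      · exact ⟨N₁, hN₁, fun z hz => hz.2.1⟩
      · exact ⟨N₂, hN₂, fun z hz => hz.2.2⟩
    have hxN : π x ∈ N := by
      have := hNχ hx
      rwa [hmap x hxV, χ.injective.mem_set_image] at this
    obtain ⟨σ, hσ, hσN, hσx⟩ := hNs x hxN
    have hσV : σ '' N ⊆ V := by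
      refine hV.1.subset_of_isPreconnected (hNc.image _ hσ) ?_ ⟨_, hxN, hσx⟩ hxV
      rintro _ ⟨z, hz, rfl⟩
      rw [mem_preimage, hσN z hz]
      exact hNa hz
    have hsymm : ∀ z ∈ disc a (D.radius a) ∩ (E.η a '' N₁ ∩ E.ηConj a '' N₂), χ.symm z ∈ N := by
      intro z hz
      obtain ⟨w, hw, rfl⟩ := hNχ hz
      rwa [χ.symm_apply_apply]
    refine ⟨fun z => σ (χ.symm z), hσ.comp χ.symm.continuous.continuousOn hsymm, fun z hz => ?_, ?_⟩
    · rw [hmap _ (hσV (mem_image_of_mem _ (hsymm z hz))), hσN _ (hsymm z hz), χ.apply_symm_apply]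
    · simp [hmap x hxV, hσx]
  -- Off the logarithmic singularities the component is a full sheet over the disc, including its
  -- centre, and the map is undeformed there. The sheet provides the section even when `y = a`.
  · obtain ⟨σ, hσ, hσe, w, rfl⟩ := (exists_isLogSingularity_or_section hX.toIsNSurface D hinf haA he
      h0 hr hπx).resolve_left hlog
    have hls := hX.toIsNSurface.locallySectioned_disc D haA
    have hF := connectedComponentIn_eq_range_section hX.isLocalHomeomorph he hσ hσe w
    rw [hr] at hF
    have hmap : ∀ v, E.map (σ v) = e v := by
      intro v
      rw [← hσe v]
      refine E.map_eq_of_forall_notMem haA (by rw [hσe, ← hr]; exact mem_range_self _)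
        fun V hV hvV => hlog ⟨V, hV, ?_⟩
      have := (IsLogSingularity.isComponentOf_disc hX.toIsNSurface D haA hV).eq_of_mem_of_mem
        (isComponentOf_connectedComponentIn hπx) hvV (by rw [hF]; exact mem_range_self _)
      rw [this]
      exact mem_connectedComponentIn hπx
    let q := he.toOpenPartialHomeomorph e
    have hqt : q.target = disc a (D.radius a) := by simp [q, hr]
    have hq : ∀ v, q v = e v := fun v => rfl
    refine ⟨fun z => σ (q.symm z), hσ.comp_continuousOn (q.continuousOn_symm.mono fun z hz => ?_),
      fun z hz => ?_, ?_⟩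
    · rw [hqt]; exact hz.1
    · rw [hmap, ← hq, q.right_inv (by rw [hqt]; exact hz.1)]
    · dsimp only
      rw [hmap, ← hq, q.left_inv (by simp [q])]

/-- The deformed map behaves like a covering outside the new base points. -/
theorem locallySectioned_map [T2Space X] (hX : IsSymmetricNSurface A π s)
    (hφ : ∀ z, φ (starRingEnd ℂ z) = s (φ z)) (E : Deformation π s D)
    (hinf : ∃ Q : Set Sphere, Q.Finite ∧ (π ⁻¹' Q).Infinite) :
    LocallySectioned E.map E.baseᶜ := by
  intro y hy
  by_cases h : ∃ a ∈ E.moved, y ∈ disc a (D.radius a)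
  · obtain ⟨a, ha, hya⟩ := h
    exact E.exists_hasSectionsOver_of_mem_disc hX hφ hinf ha hya hy
  · push Not at h
    refine E.exists_hasSectionsOver_of_notMem_disc hX hφ h fun hyA => hy (Or.inl ⟨hyA, fun hm => ?_⟩)
    exact h y hm (D.self_mem hyA)

/-- The deformed map and the original one have finite sets with infinite preimages at the same
time. -/
theorem exists_infinite_preimage (hX : IsSymmetricNSurface A π s)
    (hφ : ∀ z, φ (starRingEnd ℂ z) = s (φ z)) [T2Space X] (E : Deformation π s D) {Q : Set Sphere}
    (hQ : Q.Finite) (hinf : (E.map ⁻¹' Q).Infinite) :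
    ∃ Q' : Set Sphere, Q'.Finite ∧ (π ⁻¹' Q').Infinite := by
  have hfin := E.finite_moved hX.toIsNSurface
  refine ⟨Q ∪ ⋃ a ∈ E.moved, ⋃ χ ∈ E.models a, χ ⁻¹' Q, hQ.union (hfin.biUnion fun a _ =>
    (E.finite_models a).biUnion fun χ _ => hQ.preimage χ.injective.injOn), hinf.mono fun x hx => ?_⟩
  by_cases h : ∃ a ∈ E.moved, π x ∈ disc a (D.radius a)
  · obtain ⟨a, ha, hxa⟩ := h
    obtain ⟨χ, hχ, hmap⟩ := E.exists_model hX hφ ha (isPreconnected_singleton (x := x))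
      (singleton_subset_iff.2 hxa)
    refine Or.inr (mem_iUnion₂.2 ⟨a, ha, mem_iUnion₂.2 ⟨χ, hχ, ?_⟩⟩)
    rw [mem_preimage, ← hmap x rfl]
    exact hx
  · push Not at h
    left
    rw [← E.map_eq_of_notMem_disc h]
    exact hx

/-- Over an unmoved base point the deformed map and the original one take the same points. -/
theorem map_eq_iff_of_notMem_moved [T2Space X] (hX : IsSymmetricNSurface A π s)
    (hφ : ∀ z, φ (starRingEnd ℂ z) = s (φ z)) (E : Deformation π s D) {b : Sphere} (hb : b ∈ A)
    (hbm : b ∉ E.moved) (x : X) : E.map x = b ↔ π x = b := by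
  by_cases h : ∃ a ∈ E.moved, π x ∈ disc a (D.radius a)
  · obtain ⟨a, ha, hxa⟩ := h
    have hbd : b ∉ disc a (D.radius a) := fun hmem =>
      hbm (D.eq_of_mem hb (E.moved_subset_base ha) (D.self_mem hb) hmem ▸ ha)
    obtain ⟨χ, hχ, hmap⟩ := E.exists_model hX hφ ha (isPreconnected_singleton (x := x))
      (singleton_subset_iff.2 hxa)
    constructor
    · intro h
      exact absurd (h ▸ hmap x rfl ▸ (E.models_mem_disc ha hχ).2 hxa) hbd
    · rintro rfl
      exact absurd hxa hbd
  · push Not at h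
    rw [E.map_eq_of_notMem_disc h]

end Deformation

end Deformation

/-! ### The base graph in logarithmic coordinates -/

theorem reflection_unitPt (θ : ℝ) : reflection (unitPt θ) = unitPt θ := by
  rw [unitPt, reflection_coe (Complex.exp_ne_zero _), ← Complex.exp_conj, ← Complex.exp_neg]
  simp

/-- The reflection inverts the radius and keeps the angle. Composing a base graph with it therefore
exchanges the two vertices and leaves everything else in place, which makes `flip` possible. -/
theorem reflection_openRay (θ : ℝ) : reflection '' openRay θ = openRay θ := by
  have h : ∀ y ∈ openRay θ, reflection y ∈ openRay θ := by
    rintro _ ⟨t, ht, rfl⟩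
    refine ⟨t⁻¹, inv_pos.2 ht, ?_⟩
    rw [reflection_coe (mul_ne_zero (by exact_mod_cast ht.ne') (Complex.exp_ne_zero _)), map_mul,
      mul_inv, ← Complex.exp_conj, ← Complex.exp_neg]
    simp
  apply Subset.antisymm
  · rintro _ ⟨y, hy, rfl⟩
    exact h y hy
  · exact fun y hy => ⟨reflection y, h y hy, reflection_reflection y⟩

namespace SymmetricBaseGraph

variable {B : Set Sphere} (G : SymmetricBaseGraph B)

/-- The logarithmic coordinate on the sphere minus the two vertices. -/
def pt (w : ℂ) : Sphere := G.h ((Complex.exp w : ℂ) : Sphere)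

theorem continuous_pt : Continuous G.pt :=
  G.h.continuous.comp (OnePoint.continuous_coe.comp Complex.continuous_exp)

theorem isOpenMap_pt : IsOpenMap G.pt :=
  G.h.isOpenMap.comp (OnePoint.isOpenEmbedding_coe.isOpenMap.comp Complex.isOpenMap_exp)

theorem pt_eq_pt_iff {w z : ℂ} : G.pt w = G.pt z ↔ Complex.exp w = Complex.exp z := by
  rw [pt, pt, G.h.injective.eq_iff, OnePoint.coe_injective.eq_iff]

theorem pt_eq_pt {w z : ℂ} (h : G.pt w = G.pt z) :
    w.re = z.re ∧ ∃ n : ℤ, w.im = z.im + n * (2 * Real.pi) := by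
  obtain ⟨n, hn⟩ := Complex.exp_eq_exp_iff_exists_int.1 (G.pt_eq_pt_iff.1 h)
  rw [hn]
  exact ⟨by simp, n, by simp⟩

theorem pt_injOn {L R : ℝ} (h : R ≤ L + 2 * Real.pi) {w z : ℂ} (hw : w.im ∈ Ico L R)
    (hz : z.im ∈ Ico L R) (hwz : G.pt w = G.pt z) : w = z := by
  obtain ⟨h1, n, h2⟩ := G.pt_eq_pt hwz
  have hpi := Real.pi_pos
  have h3 : n = 0 := by
    have h4 : (n : ℝ) < 1 := by
      by_contra hn
      have := mul_le_mul_of_nonneg_right (not_lt.1 hn) Real.two_pi_pos.le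
      linarith [hw.2, hz.1]
    have h5 : (-1 : ℝ) < n := by
      by_contra hn
      have := mul_le_mul_of_nonneg_right (not_lt.1 hn) Real.two_pi_pos.le
      linarith [hw.1, hz.2]
    have h4' : n < 1 := by exact_mod_cast h4
    have h5' : -1 < n := by exact_mod_cast h5
    omega
  apply Complex.ext h1
  simpa [h3] using h2

theorem pt_ne_cross (w : ℂ) : G.pt w ≠ G.cross := fun h =>
  Complex.exp_ne_zero w (OnePoint.coe_injective (G.h.injective h))

theorem pt_ne_circ (w : ℂ) : G.pt w ≠ G.circ := fun h =>
  OnePoint.coe_ne_infty _ (G.h.injective h)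

/-- With `t` the logarithm of the radius, a ray becomes the horizontal line at height `θ`; faces of
the base graph become horizontal strips. -/
theorem image_openRay (θ : ℝ) : G.h '' openRay θ = {y | ∃ t : ℝ, y = G.pt (t + θ * Complex.I)} := by
  ext y
  constructor
  · rintro ⟨_, ⟨t, ht, rfl⟩, rfl⟩
    refine ⟨Real.log t, ?_⟩
    rw [pt, Complex.exp_add, ← Complex.ofReal_exp, Real.exp_log ht]
  · rintro ⟨t, rfl⟩
    refine ⟨_, ⟨Real.exp t, Real.exp_pos t, rfl⟩, ?_⟩
    rw [pt, Complex.exp_add, ← Complex.ofReal_exp]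

theorem mem_openEdges {y : Sphere} :
    y ∈ G.openEdges ↔ ∃ j, ∃ t : ℝ, y = G.pt (t + G.β j * Complex.I) := by
  simp only [openEdges, mem_iUnion, image_openRay, mem_ofPred_eq]

theorem exists_pt_eq {y : Sphere} (h1 : y ≠ G.cross) (h2 : y ≠ G.circ) (L : ℝ) :
    ∃ w : ℂ, w.im ∈ Ico L (L + 2 * Real.pi) ∧ G.pt w = y := by
  obtain ⟨z, rfl⟩ := G.h.surjective y
  induction z using OnePoint.rec with
  | infty => exact absurd rfl h2
  | coe z =>
    have hz : z ≠ 0 := by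
      rintro rfl
      exact h1 rfl
    have ha : toIcoMod Real.two_pi_pos L (Complex.log z).im =
      (Complex.log z).im - toIcoDiv Real.two_pi_pos L (Complex.log z).im • (2 * Real.pi) := rfl
    refine ⟨Complex.log z - (toIcoDiv Real.two_pi_pos L (Complex.log z).im : ℤ) *
      (2 * Real.pi * Complex.I), ?_, ?_⟩
    · have := toIcoMod_mem_Ico Real.two_pi_pos L (Complex.log z).im
      rw [ha] at this
      simpa using this
    · rw [pt, Complex.exp_sub, Complex.exp_log hz, Complex.exp_int_mul_two_pi_mul_I, div_one]

/-- `(L, R)` is the interval of angles of the face of the graph that contains the base point of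
angle `α`. -/
structure IsSector (L α R : ℝ) : Prop where
  left_lt : L < α
  lt_right : α < R
  width : R ≤ L + 2 * Real.pi
  left_mem : ∀ t : ℝ, G.pt (t + L * Complex.I) ∈ G.openEdges
  right_mem : ∀ t : ℝ, G.pt (t + R * Complex.I) ∈ G.openEdges
  notMem_openEdges : ∀ w : ℂ, w.im ∈ Ioo L R → G.pt w ∉ G.openEdges
  eq_of_mem_base : ∀ w : ℂ, w.im ∈ Ioo L R → G.pt w ∈ B → w = α * Complex.I

theorem β_strictMono : StrictMono G.β := by
  intro i j hij
  have h1 := (G.β_mem i).2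
  have h2 := (G.β_mem j).1
  have h3 : G.α i.succ ≤ G.α j.castSucc := G.α_strictMono.monotone (by
    rw [Fin.le_def]; simpa using hij)
  linarith

/-- The angle `L` is that of the arc cyclically preceding `β j`. With a single base point this is
the same arc one turn earlier, so the bound on the width is not strict. -/
theorem exists_angles (j : Fin G.q) : ∃ L : ℝ, L < G.α j.castSucc ∧ G.β j ≤ L + 2 * Real.pi ∧
    (∃ (k : Fin G.q) (n : ℤ), L = G.β k + n * (2 * Real.pi)) ∧
    (∀ (k : Fin G.q) (n : ℤ), G.β k + n * (2 * Real.pi) ∉ Ioo L (G.β j)) ∧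
    ∀ (k : Fin G.q) (n : ℤ), G.α k.castSucc + n * (2 * Real.pi) ∈ Ioo L (G.β j) → k = j ∧ n = 0 := by
  have hpi := Real.pi_pos
  have hα0 : ∀ i, G.α 0 ≤ G.α i := fun i => G.α_strictMono.monotone (Fin.zero_le i)
  have hαl : ∀ i, G.α i ≤ G.α 0 + 2 * Real.pi := fun i =>
    G.α_last ▸ G.α_strictMono.monotone (Fin.le_last i)
  have hαc : ∀ k : Fin G.q, G.α k.castSucc < G.α 0 + 2 * Real.pi := fun k =>
    G.α_last ▸ G.α_strictMono (Fin.castSucc_lt_last k)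
  have hβl : ∀ k, G.α 0 < G.β k := fun k => (hα0 _).trans_lt (G.β_mem k).1
  have hβr : ∀ k, G.β k < G.α 0 + 2 * Real.pi := fun k => (G.β_mem k).2.trans_le (hαl _)
  have hbig : ∀ n : ℤ, 1 ≤ n → 2 * Real.pi ≤ n * (2 * Real.pi) := fun n hn => by
    have h : (1 : ℝ) ≤ n := by exact_mod_cast hn
    nlinarith
  have hsmall : ∀ n : ℤ, n ≤ -2 → n * (2 * Real.pi) ≤ -(4 * Real.pi) := fun n hn => by
    have h : (n : ℝ) ≤ -2 := by exact_mod_cast hn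
    nlinarith
  -- The interval `(L, β j)` lies within one turn on either side of `α 0 `, so crude bounds settle
  -- all shifts but `-1` and `0`.
  have hcases : ∀ n : ℤ, n ≤ -2 ∨ n = -1 ∨ n = 0 ∨ 1 ≤ n := fun n => by omega
  rcases Nat.eq_zero_or_pos j with hj | hj
  -- The predecessor of the first arc is the last one, shifted back by a full turn.
  · set l : Fin G.q := ⟨G.q - 1, by have := j.2; omega⟩ with hl
    have hlmax : ∀ k : Fin G.q, k ≤ l := fun k => by
      rw [Fin.le_def]; have := k.2; simp only [hl]; omega
    have hjmin : ∀ k : Fin G.q, j ≤ k := fun k => by rw [Fin.le_def]; omega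
    have hj0 : j.castSucc = 0 := by ext; simpa using hj
    refine ⟨G.β l - 2 * Real.pi, ?_, ?_, ⟨l, -1, by push_cast; ring⟩, ?_, ?_⟩
    · rw [hj0]; linarith [hβr l]
    · linarith [G.β_strictMono.monotone (hjmin l)]
    · rintro k n ⟨h1, h2⟩
      have h3 := G.β_strictMono.monotone (hjmin k)
      have h4 := G.β_strictMono.monotone (hlmax k)
      have h5 := hβl k
      have h6 := hβr k
      rcases hcases n with h | rfl | rfl | h
      · linarith [hsmall n h, hβl l]
      · push_cast at h1; linarith
      · push_cast at h2; linarith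
      · linarith [hbig n h, hβr j]
    · rintro k n ⟨h1, h2⟩
      have h5 := hα0 k.castSucc
      have h6 := hαc k
      rcases hcases n with h | rfl | rfl | h
      · linarith [hsmall n h, hβl l]
      · have h7 := G.α_strictMono.monotone (a := k.castSucc) (b := l.castSucc) (by
          simpa using hlmax k)
        push_cast at h1; linarith [(G.β_mem l).1]
      · refine ⟨?_, rfl⟩
        by_contra hkj
        have hjk : j < k := lt_of_le_of_ne (hjmin k) (Ne.symm hkj)
        have h7 := G.α_strictMono.monotone (a := j.succ) (b := k.castSucc) (by
          rw [Fin.le_def]; simpa using hjk)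
        push_cast at h2; linarith [(G.β_mem j).2]
      · linarith [hbig n h, hβr j]
  · set l : Fin G.q := ⟨j - 1, by have := j.2; omega⟩ with hl
    have hlj : l.succ = j.castSucc := by
      ext; simp only [hl, Fin.val_succ, Fin.val_castSucc]; omega
    have hsplit : ∀ k : Fin G.q, k ≤ l ∨ j ≤ k := fun k => by
      rw [Fin.le_def, Fin.le_def]; simp only [hl]; omega
    have hlltj : l < j := by rw [Fin.lt_def]; simp only [hl]; omega
    refine ⟨G.β l, ?_, ?_, ⟨l, 0, by push_cast; ring⟩, ?_, ?_⟩
    · rw [← hlj]; exact (G.β_mem l).2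
    · linarith [hβl l, hβr j]
    · rintro k n ⟨h1, h2⟩
      have h5 := hβl k
      have h6 := hβr k
      rcases hcases n with h | rfl | rfl | h
      · linarith [hsmall n h, hβl l]
      · push_cast at h1; linarith [hβl l]
      · push_cast at h1 h2
        rcases hsplit k with h | h
        · linarith [G.β_strictMono.monotone h]
        · linarith [G.β_strictMono.monotone h]
      · linarith [hbig n h, hβr j]
    · rintro k n ⟨h1, h2⟩
      have h5 := hα0 k.castSucc
      have h6 := hαc k
      rcases hcases n with h | rfl | rfl | h
      · linarith [hsmall n h, hβl l]
      · push_cast at h1; linarith [hβl l]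
      · refine ⟨?_, rfl⟩
        push_cast at h1 h2
        rcases hsplit k with h | h
        · have h7 := G.α_strictMono.monotone (a := k.castSucc) (b := l.castSucc) (by simpa using h)
          linarith [(G.β_mem l).1]
        · by_contra hkj
          have hjk : j < k := lt_of_le_of_ne h (Ne.symm hkj)
          have h7 := G.α_strictMono.monotone (a := j.succ) (b := k.castSucc) (by
            rw [Fin.le_def]; simpa using hjk)
          linarith [(G.β_mem j).2]
      · linarith [hbig n h, hβr j]

theorem mem_base {b : Sphere} : b ∈ B ↔ ∃ j : Fin G.q, G.h (unitPt (G.α j.castSucc)) = b :=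
  (Set.ext_iff.1 G.base_eq b).symm

theorem exists_isSector {b : Sphere} (hb : b ∈ B) :
    ∃ L α R, G.IsSector L α R ∧ G.pt (α * Complex.I) = b := by
  obtain ⟨j, rfl⟩ := G.mem_base.1 hb
  obtain ⟨L, h1, h2, ⟨k, n, h3⟩, h4, h5⟩ := G.exists_angles j
  refine ⟨L, G.α j.castSucc, G.β j, ⟨h1, (G.β_mem j).1, h2, fun t => ?_, fun t => ?_, ?_, ?_⟩, rfl⟩
  · refine G.mem_openEdges.2 ⟨k, t, ?_⟩
    rw [pt_eq_pt_iff, Complex.exp_eq_exp_iff_exists_int]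
    exact ⟨n, by rw [h3]; push_cast; ring⟩
  · exact G.mem_openEdges.2 ⟨j, t, rfl⟩
  · intro w hw h
    obtain ⟨i, t, hi⟩ := G.mem_openEdges.1 h
    obtain ⟨_, m, hm⟩ := G.pt_eq_pt hi
    have hm' : w.im = G.β i + m * (2 * Real.pi) := by simpa using hm
    exact h4 i m (hm' ▸ hw)
  · intro w hw h
    obtain ⟨i, hi⟩ := G.mem_base.1 h
    obtain ⟨hre, m, hm⟩ := G.pt_eq_pt (z := G.α i.castSucc * Complex.I) hi.symm
    simp only [Complex.mul_im, Complex.ofReal_re, Complex.I_im, mul_one, Complex.ofReal_im,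
      Complex.I_re, mul_zero, add_zero] at hm
    obtain ⟨rfl, rfl⟩ := h5 i m (hm ▸ hw)
    apply Complex.ext
    · simpa using hre
    · simpa using hm

theorem cross_notMem_base : G.cross ∉ B := by
  intro h
  obtain ⟨j, hj⟩ := G.mem_base.1 h
  exact G.pt_ne_cross _ hj

theorem openEdges_disjoint_base {y : Sphere} (hy : y ∈ G.openEdges) : y ∉ B := by
  intro hb
  obtain ⟨L, α, R, h, rfl⟩ := G.exists_isSector hb
  exact h.notMem_openEdges _ (by simpa using ⟨h.left_lt, h.lt_right⟩) hy

namespace IsSector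

variable {G} {L α R : ℝ} (hS : G.IsSector L α R)
include hS

/-- The face of the graph, in terms of the logarithmic coordinate. -/
theorem connectedComponentIn_eq :
    connectedComponentIn G.graphᶜ (G.pt (α * Complex.I)) = G.pt '' {w | w.im ∈ Ioo L R} := by
  have hstrip : ∀ a b : ℝ, IsOpen (G.pt '' {w | w.im ∈ Ioo a b}) := fun a b =>
    G.isOpenMap_pt _ (isOpen_Ioo.preimage Complex.continuous_im)
  refine connectedComponentIn_eq_of_isOpen ?_ (hstrip L R)
    ⟨_, by simpa using ⟨hS.left_lt, hS.lt_right⟩, rfl⟩ ?_ ?_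
  · have : Convex ℝ {w : ℂ | w.im ∈ Ioo L R} :=
      (convex_halfSpace_im_gt L).inter (convex_halfSpace_im_lt R)
    exact this.isPreconnected.image _ G.continuous_pt.continuousOn
  · rintro _ ⟨w, hw, rfl⟩ h
    rcases h with (h | h) | h
    · exact G.pt_ne_cross _ h
    · exact G.pt_ne_circ _ h
    · exact hS.notMem_openEdges w hw h
  · rintro y ⟨hy, hyg⟩
    have hyc : y ≠ G.cross := fun h => hyg (Or.inl (Or.inl h))
    have hyc' : y ≠ G.circ := fun h => hyg (Or.inl (Or.inr h))
    obtain ⟨w, hw, rfl⟩ := G.exists_pt_eq hyc hyc' L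
    have hwL : w.im ≠ L := by
      intro h
      refine hyg (Or.inr ?_)
      have := hS.left_mem w.re
      rwa [← h, Complex.re_add_im] at this
    have hwR : w.im ≠ R := by
      intro h
      refine hyg (Or.inr ?_)
      have := hS.right_mem w.re
      rwa [← h, Complex.re_add_im] at this
    have hLw : L < w.im := lt_of_le_of_ne hw.1 (Ne.symm hwL)
    by_contra hcon
    have hRw : R < w.im := by
      refine lt_of_le_of_ne (not_lt.1 fun h => hcon ⟨w, ⟨hLw, h⟩, rfl⟩) (Ne.symm hwR)
    obtain ⟨_, ⟨v, hv, rfl⟩, ⟨u, hu, huv⟩⟩ := mem_closure_iff.1 hy _ (hstrip R (L + 2 * Real.pi))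
      ⟨w, ⟨hRw, hw.2⟩, rfl⟩
    have := G.pt_injOn le_rfl ⟨hu.1.le, hu.2.trans_le hS.width⟩
      ⟨((hS.left_lt.trans hS.lt_right).trans hv.1).le, hv.2⟩ huv
    rw [this] at hu
    exact lt_asymm hv.1 hu.2

/-- The plane is squeezed vertically onto the strip, which `pt` maps injectively as its width is at
most `2π`. The sign of the real part is reversed so that the positive axis of the chart runs towards
`×`, the direction in which rays are lifted. -/
theorem exists_chart : ∃ e : ℂ → Sphere, IsOpenEmbedding e ∧
    (∀ t : ℝ, e t = G.pt (-t + α * Complex.I)) ∧ range e = G.pt '' {w | w.im ∈ Ioo L R} := by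
  have hLR : L < R := hS.left_lt.trans hS.lt_right
  let g := OpenPartialHomeomorph.univBall ((L + R) / 2 : ℝ) ((R - L) / 2)
  have hg : IsOpenEmbedding g := g.isOpenEmbedding (OpenPartialHomeomorph.univBall_source _ _)
  have hgr : range g = Ioo L R := by
    rw [← image_univ, ← OpenPartialHomeomorph.univBall_source ((L + R) / 2 : ℝ) ((R - L) / 2),
      g.image_source_eq_target, OpenPartialHomeomorph.univBall_target _ (by linarith),
      Real.ball_eq_Ioo]
    congr 1 <;> ring
  obtain ⟨y₀, hy₀⟩ : α ∈ range g := hgr ▸ ⟨hS.left_lt, hS.lt_right⟩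
  let k : ℂ → ℂ := fun w => Complex.equivRealProdCLM.symm
    (Prod.map (fun x : ℝ => -x) (fun y => g (y + y₀)) (Complex.equivRealProdCLM w))
  have hkim : ∀ w, (k w).im = g (w.im + y₀) := fun w => by
    simp [k, Complex.equivRealProdCLM_symm_apply]
  have hkre : ∀ w, (k w).re = -w.re := fun w => by
    simp [k, Complex.equivRealProdCLM_symm_apply]
  have hk : IsOpenEmbedding k :=
    Complex.equivRealProdCLM.symm.toHomeomorph.isOpenEmbedding.comp
      (((Homeomorph.neg ℝ).isOpenEmbedding.prodMap
        (hg.comp (Homeomorph.addRight y₀).isOpenEmbedding)).comp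
        Complex.equivRealProdCLM.toHomeomorph.isOpenEmbedding)
  have hkm : ∀ w, (k w).im ∈ Ioo L R := fun w => by
    rw [hkim, ← hgr]; exact mem_range_self _
  refine ⟨fun w => G.pt (k w), ?_, fun t => ?_, ?_⟩
  · refine IsOpenEmbedding.of_continuous_injective_isOpenMap (G.continuous_pt.comp hk.continuous)
      (fun w z h => hk.injective (G.pt_injOn hS.width ?_ ?_ h)) (G.isOpenMap_pt.comp hk.isOpenMap)
    · exact ⟨(hkm w).1.le, (hkm w).2⟩
    · exact ⟨(hkm z).1.le, (hkm z).2⟩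
  · have : k t = -t + α * Complex.I := by
      apply Complex.ext
      · simp [hkre]
      · simp [hkim, hy₀]
    exact congrArg G.pt this
  · ext y
    constructor
    · rintro ⟨w, rfl⟩
      exact ⟨_, hkm w, rfl⟩
    · rintro ⟨w, hw, rfl⟩
      obtain ⟨y, hy⟩ : w.im ∈ range g := hgr ▸ hw
      refine ⟨⟨-w.re, y - y₀⟩, ?_⟩
      dsimp only
      congr 1
      apply Complex.ext
      · simp [hkre]
      · simp [hkim, hy]

end IsSector

theorem conj_cross : conj G.cross = G.cross := by
  rw [cross, ← G.h_conj]; simp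

theorem conj_circ : conj G.circ = G.circ := by
  rw [circ, ← G.h_conj]; simp

theorem image_conj_graph : conj '' G.graph = G.graph := by
  rw [graph, image_union, image_insert_eq, image_singleton, conj_cross, conj_circ]
  congr 1
  exact G.symm

/-- Exchanging the two vertices of the base graph. -/
def flip : SymmetricBaseGraph B where
  h := reflectionHomeo.trans G.h
  h_conj y := by
    rw [Homeomorph.trans_apply, Homeomorph.trans_apply, reflectionHomeo_apply, reflection_conj,
      G.h_conj, reflectionHomeo_apply]
  q := G.q
  α := G.α
  α_strictMono := G.α_strictMono
  α_last := G.α_last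
  β := G.β
  β_mem := G.β_mem
  base_eq := by
    simp only [Homeomorph.trans_apply, reflectionHomeo_apply, reflection_unitPt]
    exact G.base_eq
  symm := by
    have : ∀ j, (reflectionHomeo.trans G.h) '' openRay (G.β j) = G.h '' openRay (G.β j) := by
      intro j
      conv_rhs => rw [← reflection_openRay, image_image]
      rfl
    simp only [this]
    exact G.symm

theorem flip_cross : G.flip.cross = G.circ := by
  simp [flip, cross, circ]

theorem flip_circ : G.flip.circ = G.cross := by
  simp [flip, cross, circ]

theorem flip_openEdges : G.flip.openEdges = G.openEdges := by
  have : ∀ j, G.flip.h '' openRay (G.β j) = G.h '' openRay (G.β j) := by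
    intro j
    conv_rhs => rw [← reflection_openRay, image_image]
    rfl
  exact iUnion_congr this

theorem flip_graph : G.flip.graph = G.graph := by
  rw [graph, graph, flip_openEdges, flip_cross, flip_circ, pair_comm]

end SymmetricBaseGraph

/-! ### Faces and vertices of the preimage graph -/

namespace SymmetricBaseGraph

variable {X : Type*} [TopologicalSpace X] {p : X → Sphere} {B : Set Sphere}
  {G : SymmetricBaseGraph B}

theorem tendsto_pt_atBot (θ : ℝ) :
    Filter.Tendsto (fun t : ℝ => G.pt (t + θ * Complex.I)) Filter.atBot (𝓝 G.cross) := by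
  have h : Filter.Tendsto (fun t : ℝ => Complex.exp (t + θ * Complex.I)) Filter.atBot (𝓝 0) := by
    rw [tendsto_zero_iff_norm_tendsto_zero]
    simpa [Complex.norm_exp] using Real.tendsto_exp_atBot
  exact ((G.h.continuous.comp OnePoint.continuous_coe).tendsto 0).comp h

/-- Left half-planes of the logarithmic coordinate are punctured neighbourhoods of `×`. -/
theorem eventually_re_lt (hp : Continuous p) {v : X} (hv : p v = G.cross) (T : ℝ) :
    ∀ᶠ u in 𝓝 v, ∀ w, p u = G.pt w → w.re < T := by
  have hN : IsOpen (G.h '' ((fun z : ℂ => (z : Sphere)) '' Metric.ball 0 (Real.exp T))) :=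
    G.h.isOpenMap _ (OnePoint.isOpenEmbedding_coe.isOpenMap _ Metric.isOpen_ball)
  have hvN : p v ∈ G.h '' ((fun z : ℂ => (z : Sphere)) '' Metric.ball 0 (Real.exp T)) := by
    rw [hv]
    exact ⟨_, ⟨0, by simp [Real.exp_pos], rfl⟩, rfl⟩
  filter_upwards [(hN.preimage hp).mem_nhds hvN] with u hu w hw
  obtain ⟨_, ⟨z, hz, rfl⟩, hzu⟩ := hu
  rw [hw, pt] at hzu
  have := OnePoint.coe_injective (G.h.injective hzu)
  rw [this, mem_ball_zero_iff, Complex.norm_exp, Real.exp_lt_exp] at hz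
  exact hz

/-- A local section near a vertex, in the logarithmic coordinate. -/
theorem exists_section_cross (hp : IsLocalHomeomorph p) {v : X} (hv : p v = G.cross) {W : Set X}
    (hW : W ∈ 𝓝 v) : ∃ O ∈ 𝓝 v, O ⊆ W ∧ InjOn p O ∧ ∃ (T : ℝ) (σ : ℂ → X),
      ContinuousOn σ {w | w.re < T} ∧ (∀ w, w.re < T → σ w ∈ O ∧ p (σ w) = G.pt w) ∧
      ∀ θ : ℝ, Filter.Tendsto (fun t : ℝ => σ (t + θ * Complex.I)) Filter.atBot (𝓝 v) := by
  obtain ⟨q, hvq, rfl⟩ := hp v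
  have hN : IsOpen (q.target ∩ q.symm ⁻¹' interior W) :=
    q.symm.isOpen_inter_preimage isOpen_interior
  have hcr : G.cross ∈ q.target := hv ▸ q.map_source hvq
  have hqc : q.symm G.cross = v := by rw [← hv, q.left_inv hvq]
  have hcN : G.cross ∈ q.target ∩ q.symm ⁻¹' interior W :=
    ⟨hcr, by rw [mem_preimage, hqc]; exact mem_interior_iff_mem_nhds.2 hW⟩
  have hpre : (fun z : ℂ => G.h (z : Sphere)) ⁻¹' (q.target ∩ q.symm ⁻¹' interior W) ∈ 𝓝 (0 : ℂ) :=
    (G.h.continuous.comp OnePoint.continuous_coe).continuousAt (hN.mem_nhds hcN)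
  obtain ⟨δ, hδ, hb⟩ := Metric.mem_nhds_iff.1 hpre
  have hT : ∀ w : ℂ, w.re < Real.log δ → G.pt w ∈ q.target ∩ q.symm ⁻¹' interior W := by
    intro w hw
    refine hb (mem_ball_zero_iff.2 ?_)
    rw [Complex.norm_exp]
    exact (Real.lt_log_iff_exp_lt hδ).1 hw
  refine ⟨q.source ∩ W, Filter.inter_mem (q.open_source.mem_nhds hvq) hW, inter_subset_right,
    q.injOn.mono inter_subset_left, Real.log δ, fun w => q.symm (G.pt w), ?_, ?_, ?_⟩
  · exact q.continuousOn_symm.comp G.continuous_pt.continuousOn fun w hw => (hT w hw).1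
  · intro w hw
    exact ⟨⟨q.map_target (hT w hw).1, interior_subset (hT w hw).2⟩, q.right_inv (hT w hw).1⟩
  · intro θ
    have := (q.continuousAt_symm hcr).tendsto.comp (G.tendsto_pt_atBot θ)
    rwa [hqc] at this

/-- Rays towards a vertex lift. -/
theorem exists_ray_lift (hl : LocallySectioned p Bᶜ) {u : X} {t₀ θ : ℝ}
    (hu : p u = G.pt (t₀ + θ * Complex.I)) (hB : ∀ t ≤ t₀, G.pt (t + θ * Complex.I) ∉ B) :
    ∃ (U : ℝ → X) (v : X), ContinuousOn U (Iic t₀) ∧ U t₀ = u ∧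
      (∀ t ≤ t₀, p (U t) = G.pt (t + θ * Complex.I)) ∧ p v = G.cross ∧
      Filter.Tendsto U Filter.atBot (𝓝 v) := by
  -- The radial path in linear parametrization reaches `×` at time `1`. As `×` is not a base point,
  -- the lift extends to that time, and its endpoint is the vertex `v`.
  let γ : C(unitInterval, Sphere) :=
    ⟨fun τ => G.h (((((1 - (τ : ℝ) : ℝ) : ℂ) * Complex.exp (t₀ + θ * Complex.I) : ℂ)) : Sphere),
      G.h.continuous.comp (OnePoint.continuous_coe.comp (by fun_prop))⟩
  have hγpt : ∀ t ≤ t₀, ((Real.exp (t - t₀) : ℝ) : ℂ) * Complex.exp (t₀ + θ * Complex.I) =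
      Complex.exp (t + θ * Complex.I) := by
    intro t _
    rw [Complex.ofReal_exp, ← Complex.exp_add]
    congr 1
    push_cast
    ring
  have hγB : ∀ τ, γ τ ∈ Bᶜ := by
    intro τ
    rcases τ.2.2.eq_or_lt with h | h
    · have : γ τ = G.cross := by simp [γ, h, cross]
      rw [this]
      exact G.cross_notMem_base
    · have hpos : 0 < 1 - (τ : ℝ) := by linarith
      have hle : Real.log (1 - τ) + t₀ ≤ t₀ := by
        have := Real.log_nonpos hpos.le (by linarith [τ.2.1])
        linarith
      have := hγpt _ hle
      rw [add_sub_cancel_right, Real.exp_log hpos] at this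
      have h2 : γ τ = G.pt ((Real.log (1 - τ) + t₀ : ℝ) + θ * Complex.I) :=
        congrArg (fun z : ℂ => G.h (z : Sphere)) this
      rw [h2]
      exact hB _ hle
  obtain ⟨Γ, hΓ0, hΓ⟩ := hl.exists_lift γ hγB u (by simp [hu, γ, pt])
  have hc : Continuous fun t : ℝ => Γ (projIcc 0 1 zero_le_one (1 - Real.exp (t - t₀))) :=
    Γ.continuous.comp (continuous_projIcc.comp (by fun_prop))
  refine ⟨fun t => Γ (projIcc 0 1 zero_le_one (1 - Real.exp (t - t₀))), Γ 1, hc.continuousOn,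
    ?_, ?_, ?_, ?_⟩
  · simpa using hΓ0
  · intro t ht
    have hmem : 1 - Real.exp (t - t₀) ∈ Icc (0 : ℝ) 1 :=
      ⟨by linarith [Real.exp_le_one_iff.2 (sub_nonpos.2 ht)], by linarith [Real.exp_pos (t - t₀)]⟩
    rw [hΓ, projIcc_of_mem _ hmem, pt, ← hγpt t ht]
    simp [γ]
  · rw [hΓ]
    simp [γ, cross]
  · have h1 : Filter.Tendsto (fun t : ℝ => 1 - Real.exp (t - t₀)) Filter.atBot (𝓝 (1 - 0)) :=
      tendsto_const_nhds.sub (Real.tendsto_exp_atBot.comp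
        (Filter.tendsto_atBot_add_const_right _ _ Filter.tendsto_id))
    have h2 : Continuous fun r : ℝ => Γ (projIcc 0 1 zero_le_one r) :=
      Γ.continuous.comp continuous_projIcc
    have h3 := (h2.tendsto (1 - 0)).comp h1
    simpa [Function.comp_def] using h3

theorem image_ray_subset {T C : Set X} (hC : IsComponentOf T C) {U : ℝ → X} {t₀ : ℝ}
    (hU : ContinuousOn U (Iic t₀)) (hUT : ∀ t ≤ t₀, U t ∈ T) (h0 : U t₀ ∈ C) {t : ℝ} (ht : t ≤ t₀) :
    U t ∈ C :=
  hC.subset_of_isPreconnected (isPreconnected_Iic.image U hU)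
    (by rintro _ ⟨t, ht, rfl⟩; exact hUT t ht) (mem_image_of_mem U self_mem_Iic) h0
    (mem_image_of_mem U ht)

theorem mem_closure_of_ray {C : Set X} {U : ℝ → X} {t₀ : ℝ} {v : X} (h : ∀ t ≤ t₀, U t ∈ C)
    (hv : Filter.Tendsto U Filter.atBot (𝓝 v)) : v ∈ closure C :=
  mem_closure_of_tendsto hv (Filter.eventually_atBot.2 ⟨t₀, h⟩)

theorem vertices_finite : ({G.cross, G.circ} : Set Sphere).Finite := by simp

theorem cross_notMem_component (y : Sphere) : G.cross ∉ connectedComponentIn G.graphᶜ y :=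
  fun h => connectedComponentIn_subset _ _ h (Or.inl (Or.inl rfl))

theorem circ_notMem_component (y : Sphere) : G.circ ∉ connectedComponentIn G.graphᶜ y :=
  fun h => connectedComponentIn_subset _ _ h (Or.inl (Or.inr rfl))

namespace IsSector

variable {L α R : ℝ} (hS : G.IsSector L α R) {F : Set X}
  (hF : IsComponentOf (p ⁻¹' connectedComponentIn G.graphᶜ (G.pt (α * Complex.I))) F)
include hS

theorem pt_mem {w : ℂ} : G.pt w ∈ connectedComponentIn G.graphᶜ (G.pt (α * Complex.I)) ↔
    ∃ z, z.im ∈ Ioo L R ∧ G.pt z = G.pt w := by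
  rw [hS.connectedComponentIn_eq]; rfl

theorem pt_axis_mem (t : ℝ) :
    G.pt (t + α * Complex.I) ∈ connectedComponentIn G.graphᶜ (G.pt (α * Complex.I)) :=
  hS.pt_mem.2 ⟨_, by simpa using ⟨hS.left_lt, hS.lt_right⟩, rfl⟩

theorem diff_subset_compl_base :
    connectedComponentIn G.graphᶜ (G.pt (α * Complex.I)) \ {G.pt (α * Complex.I)} ⊆ Bᶜ := by
  rintro y ⟨hy, hne⟩ hB
  rw [hS.connectedComponentIn_eq] at hy
  obtain ⟨w, hw, rfl⟩ := hy
  exact hne (by rw [hS.eq_of_mem_base w hw hB]; rfl)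

theorem axis_notMem_base {t : ℝ} (ht : t ≠ 0) : G.pt (t + α * Complex.I) ∉ B := by
  intro h
  have := hS.eq_of_mem_base _ (by simpa using ⟨hS.left_lt, hS.lt_right⟩) h
  exact ht (by simpa using this)

include hF

/-- Near a vertex, a face contains the sector that is mapped to the face of the base graph. -/
theorem exists_mem_of_mem_closure (hp : IsLocalHomeomorph p) {v : X} (hv : p v = G.cross)
    (hvF : v ∈ closure F) {W : Set X} (hW : W ∈ 𝓝 v) :
    ∃ T : ℝ, ∀ t < T, ∃ u ∈ W ∩ F, p u = G.pt (t + α * Complex.I) := by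
  obtain ⟨O, hO, hOW, hinj, T, σ, hσ, hσO, _⟩ := exists_section_cross (G := G) hp hv hW
  obtain ⟨u, ⟨huO, huT⟩, huF⟩ := mem_closure_iff_nhds.1 hvF _
    (Filter.inter_mem hO (eventually_re_lt hp.continuous hv T))
  -- The local section maps this half-strip to a connected set over the base face. It meets `F`,
  -- hence lies in `F`.
  have hconv : Convex ℝ {w : ℂ | w.re < T ∧ w.im ∈ Ioo L R} :=
    (convex_halfSpace_re_lt T).inter
      ((convex_halfSpace_im_gt L).inter (convex_halfSpace_im_lt R))
  have huΩ := hF.subset huF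
  rw [mem_preimage, hS.connectedComponentIn_eq] at huΩ
  obtain ⟨w, hw, hwu⟩ := huΩ
  have hwT := huT w hwu.symm
  have hσw : σ w = u := hinj (hσO w hwT).1 huO ((hσO w hwT).2.trans hwu)
  have hsub : σ '' {w : ℂ | w.re < T ∧ w.im ∈ Ioo L R} ⊆ F := by
    refine hF.subset_of_isPreconnected (hconv.isPreconnected.image σ (hσ.mono fun w hw => hw.1)) ?_
      ⟨w, ⟨hwT, hw⟩, hσw⟩ huF
    rintro _ ⟨z, hz, rfl⟩
    rw [mem_preimage, (hσO z hz.1).2, hS.pt_mem]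
    exact ⟨z, hz.2, rfl⟩
  refine ⟨T, fun t ht => ⟨σ (t + α * Complex.I), ⟨?_, ?_⟩, ?_⟩⟩
  · exact hOW (hσO _ (by simpa using ht)).1
  · exact hsub (mem_image_of_mem σ (by simpa using ⟨ht, hS.left_lt, hS.lt_right⟩))
  · exact (hσO _ (by simpa using ht)).2

/-- A vertex lies on the boundary of only one face of a given label. -/
theorem face_unique (hp : IsLocalHomeomorph p) {F' : Set X}
    (hF' : IsComponentOf (p ⁻¹' connectedComponentIn G.graphᶜ (G.pt (α * Complex.I))) F')
    {v : X} (hv : p v = G.cross) (hvF : v ∈ closure F) (hvF' : v ∈ closure F') : F = F' := by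
  obtain ⟨W, hW, hinj⟩ := isLocallyInjective_iff_nhds.1 hp.isLocallyInjective v
  obtain ⟨T, hT⟩ := hS.exists_mem_of_mem_closure hF hp hv hvF hW
  obtain ⟨T', hT'⟩ := hS.exists_mem_of_mem_closure hF' hp hv hvF' hW
  obtain ⟨u, ⟨hu, huF⟩, hpu⟩ := hT (min T T' - 1) (by linarith [min_le_left T T'])
  obtain ⟨u', ⟨hu', huF'⟩, hpu'⟩ := hT' (min T T' - 1) (by linarith [min_le_right T T'])
  have := hinj hu hu' (hpu.trans hpu'.symm)
  exact hF.eq_of_mem_of_mem hF' huF (this ▸ huF')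

/-- A face that is mapped injectively has only one vertex of each kind. -/
theorem cross_unique [T2Space X] (hp : IsLocalHomeomorph p) (hinj : InjOn p F) {v v' : X}
    (hv : p v = G.cross) (hv' : p v' = G.cross) (hvF : v ∈ closure F) (hvF' : v' ∈ closure F) :
    v = v' := by
  by_contra hne
  obtain ⟨W, W', hW, hW', hvW, hvW', hd⟩ := t2_separation hne
  obtain ⟨T, hT⟩ := hS.exists_mem_of_mem_closure hF hp hv hvF (hW.mem_nhds hvW)
  obtain ⟨T', hT'⟩ := hS.exists_mem_of_mem_closure hF hp hv' hvF' (hW'.mem_nhds hvW')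
  obtain ⟨u, ⟨hu, huF⟩, hpu⟩ := hT (min T T' - 1) (by linarith [min_le_left T T'])
  obtain ⟨u', ⟨hu', huF'⟩, hpu'⟩ := hT' (min T T' - 1) (by linarith [min_le_right T T'])
  rw [hinj huF huF' (hpu.trans hpu'.symm)] at hu
  exact disjoint_left.1 hd hu hu'

omit hF

/-- Every vertex lies on the boundary of a face of a given label. -/
theorem exists_face (hp : IsLocalHomeomorph p) {v : X} (hv : p v = G.cross) :
    ∃ F, IsComponentOf (p ⁻¹' connectedComponentIn G.graphᶜ (G.pt (α * Complex.I))) F ∧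
      v ∈ closure F := by
  obtain ⟨O, hO, hOW, hinj, T, σ, hσ, hσO, hlim⟩ :=
    exists_section_cross (G := G) hp hv Filter.univ_mem
  have hmem : ∀ t ≤ T - 1, σ (t + α * Complex.I) ∈
      p ⁻¹' connectedComponentIn G.graphᶜ (G.pt (α * Complex.I)) := by
    intro t ht
    rw [mem_preimage, (hσO _ (by simp; linarith)).2]
    exact hS.pt_axis_mem t
  have hC := isComponentOf_connectedComponentIn (hmem (T - 1) le_rfl)
  refine ⟨_, hC, mem_closure_of_ray (t₀ := T - 1) (U := fun t : ℝ => σ (t + α * Complex.I))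
    (fun t ht => ?_) (hlim α)⟩
  refine image_ray_subset hC (U := fun t : ℝ => σ (t + α * Complex.I)) ?_ hmem
    (mem_connectedComponentIn (hmem (T - 1) le_rfl)) ht
  refine hσ.comp (by fun_prop) fun t ht => ?_
  have : t ≤ T - 1 := ht
  simp only [mem_ofPred_eq, Complex.add_re, Complex.ofReal_re, Complex.mul_re, Complex.I_re,
    mul_zero, Complex.ofReal_im, Complex.I_im, mul_one, sub_self, add_zero]
  linarith

include hF

/-- A face of finitely many vertices has finite degree. -/
theorem finite_fibre [T2Space X] (hp : IsLocalHomeomorph p) (hl : LocallySectioned p Bᶜ)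
    (hfin : (p ⁻¹' {G.cross} ∩ frontier F).Finite) {t₀ : ℝ} (ht₀ : t₀ < 0) :
    {u ∈ F | p u = G.pt (t₀ + α * Complex.I)}.Finite := by
  have hlift := fun u : {u ∈ F | p u = G.pt (t₀ + α * Complex.I)} =>
    exists_ray_lift (G := G) hl u.2.2 fun t ht => hS.axis_notMem_base (by linarith)
  choose U v hU hU0 hUp hv hlim using hlift
  have hUF : ∀ u, ∀ t ≤ t₀, U u t ∈ F := fun u t ht =>
    image_ray_subset hF (hU u) (fun t ht => by
      rw [mem_preimage, hUp u t ht]; exact hS.pt_axis_mem t) (by rw [hU0]; exact u.2.1) ht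
  have hvf : ∀ u, v u ∈ p ⁻¹' {G.cross} ∩ frontier F := by
    refine fun u => ⟨hv u, mem_closure_of_ray (hUF u) (hlim u), fun h => ?_⟩
    have := hF.subset (interior_subset h)
    rw [mem_preimage, hv u] at this
    exact G.cross_notMem_component _ this
  -- Two lifted rays with the same end agree near it by local injectivity, and hence throughout. So
  -- the fibre embeds into the vertices of the face.
  have hinjv : Function.Injective v := by
    intro u u' h
    obtain ⟨W, hW, hinj⟩ := isLocallyInjective_iff_nhds.1 hp.isLocallyInjective (v u)
    have h1 := (hlim u).eventually hW
    have h2 := (hlim u').eventually (h ▸ hW)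
    obtain ⟨t, ⟨ht1, ht2⟩, ht⟩ := ((h1.and h2).and (Filter.eventually_le_atBot t₀)).exists
    have heq := hinj ht1 ht2 ((hUp u t ht).trans (hUp u' t ht).symm)
    have := (T2Space.isSeparatedMap p).eqOn_of_comp_eqOn hp.isLocallyInjective isPreconnected_Iic
      (hU u) (hU u') (fun s hs => (hUp u s hs).trans (hUp u' s hs).symm) ht heq
      (self_mem_Iic (a := t₀))
    rw [hU0, hU0] at this
    exact Subtype.ext this
  have : Finite (p ⁻¹' {G.cross} ∩ frontier F : Set X) := hfin
  exact Finite.of_injective (fun u => (⟨v u, hvf u⟩ : (p ⁻¹' {G.cross} ∩ frontier F : Set X)))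
    fun u u' h => hinjv (congrArg Subtype.val h)

/-- If there are infinitely many vertices, then a face with finitely many vertices contains a
preimage of its label. -/
theorem exists_mem_center [T2Space X] (hp : IsLocalHomeomorph p) (hl : LocallySectioned p Bᶜ)
    (φ : ℂ ≃ₜ X) (hinf : (p ⁻¹' {G.cross, G.circ}).Infinite)
    (hfin : (p ⁻¹' {G.cross} ∩ frontier F).Finite) : ∃ x ∈ F, p x = G.pt (α * Complex.I) := by
  by_contra hno
  push Not at hno
  obtain ⟨e, he, het, her⟩ := hS.exists_chart
  rw [← hS.connectedComponentIn_eq] at her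
  have he0 : e 0 = G.pt (α * Complex.I) := by simpa using het 0
  obtain ⟨K, hK, hKc⟩ := exists_isCompact_compl_subset hp φ he
    (hl.mono (by rw [her, he0]; exact hS.diff_subset_compl_base)) (by rwa [her])
    (by rwa [he0]) one_pos (F := F) (by
      have := hS.finite_fibre hF hp hl hfin (t₀ := -1) (by norm_num)
      rw [het]
      simpa using this)
  -- Faces contain no vertices, so all vertices lie in the compact set `K` outside which everything
  -- belongs to `F`.
  refine hinf ((finite_inter_preimage_of_isCompact hp vertices_finite hK).subset
    fun u hu => ⟨?_, hu⟩)
  by_contra huK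
  have h1 := hF.subset (hKc huK).1
  rw [mem_preimage] at h1
  rcases hu with h | h
  · rw [h] at h1; exact G.cross_notMem_component _ h1
  · rw [show p u = G.circ from h] at h1; exact G.circ_notMem_component _ h1

variable {x : X} (hxF : x ∈ F) (hx : p x = G.pt (α * Complex.I))
include hxF hx

/-- A face that contains a preimage of its label is the image of a section. -/
theorem exists_section [T2Space X] (hp : IsLocalHomeomorph p) (hl : LocallySectioned p Bᶜ) :
    ∃ (e : ℂ → Sphere) (σ : ℂ → X), Function.Injective e ∧ e 1 = G.pt ((-1 : ℝ) + α * Complex.I) ∧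
      (∀ w, p (σ w) = e w) ∧ F = range σ := by
  obtain ⟨e, he, het, her⟩ := hS.exists_chart
  rw [← hS.connectedComponentIn_eq] at her
  have he0 : e 0 = G.pt (α * Complex.I) := by simpa using het 0
  obtain ⟨σ, hσ, hσe, hσ0⟩ := exists_section_disc hp he
    (hl.mono (by rw [her, he0]; exact hS.diff_subset_compl_base)) (hx.trans he0.symm)
  have hFσ := connectedComponentIn_eq_range_section hp he hσ hσe 0
  rw [hσ0, her, ← hF.eq_of_mem hxF] at hFσ
  exact ⟨e, σ, he.injective, by simpa using het 1, hσe, hFσ⟩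

/-- A face that contains a preimage of its label is mapped injectively. -/
theorem injOn_face [T2Space X] (hp : IsLocalHomeomorph p) (hl : LocallySectioned p Bᶜ) :
    InjOn p F := by
  obtain ⟨e, σ, he, _, hσe, rfl⟩ := hS.exists_section hF hxF hx hp hl
  rintro _ ⟨w, rfl⟩ _ ⟨w', rfl⟩ h
  rw [hσe, hσe] at h
  rw [he h]

/-- A face that contains a preimage of its label has a vertex. -/
theorem exists_cross [T2Space X] (hp : IsLocalHomeomorph p) (hl : LocallySectioned p Bᶜ) :
    ∃ v ∈ frontier F, p v = G.cross := by
  obtain ⟨e, σ, _, he1, hσe, hFσ⟩ := hS.exists_section hF hxF hx hp hl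
  obtain ⟨U, v, hU, hU0, hUp, hv, hlim⟩ := exists_ray_lift (G := G) hl ((hσe 1).trans he1)
    fun t ht => hS.axis_notMem_base (by linarith)
  refine ⟨v, ⟨mem_closure_of_ray (t₀ := -1) (fun t ht => image_ray_subset hF hU (fun t ht => by
      rw [mem_preimage, hUp t ht]; exact hS.pt_axis_mem t)
      (by rw [hU0, hFσ]; exact mem_range_self _) ht) hlim, fun h => ?_⟩, hv⟩
  have := hF.subset (interior_subset h)
  rw [mem_preimage, hv] at this
  exact G.cross_notMem_component _ this

/-- A face that contains a preimage of its label has finitely many boundary edges. -/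
theorem finite_edges [T2Space X] (hp : IsLocalHomeomorph p) (hl : LocallySectioned p Bᶜ) :
    {e | IsComponentOf (p ⁻¹' G.openEdges) e ∧ e ⊆ frontier F}.Finite := by
  have hinj := hS.injOn_face hF hxF hx hp hl
  have hcov : {e | IsComponentOf (p ⁻¹' G.openEdges) e ∧ e ⊆ frontier F} ⊆
      ⋃ j : Fin G.q, {e | IsComponentOf (p ⁻¹' G.openEdges) e ∧ e ⊆ frontier F ∧
        ∃ u ∈ e, ∃ t : ℝ, p u = G.pt (t + G.β j * Complex.I)} := by
    rintro e ⟨he, heF⟩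
    obtain ⟨u, hu⟩ := he.nonempty
    obtain ⟨j, t, ht⟩ := G.mem_openEdges.1 (he.subset hu)
    exact mem_iUnion.2 ⟨j, he, heF, u, hu, t, ht⟩
  -- There is at most one boundary edge over each arc: every such edge ends at the unique vertex of
  -- `F` over `×`, near which `p` is injective.
  refine (finite_iUnion fun j => Subsingleton.finite ?_).subset hcov
  have key : ∀ e, IsComponentOf (p ⁻¹' G.openEdges) e → e ⊆ frontier F →
      (∃ u ∈ e, ∃ t : ℝ, p u = G.pt (t + G.β j * Complex.I)) →
      ∃ (U : ℝ → X) (v : X) (t₀ : ℝ), (∀ t ≤ t₀, U t ∈ e ∧ p (U t) = G.pt (t + G.β j * Complex.I)) ∧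
        p v = G.cross ∧ v ∈ closure F ∧ Filter.Tendsto U Filter.atBot (𝓝 v) := by
    rintro e he heF ⟨u, hu, t₀, ht₀⟩
    obtain ⟨U, v, hU, hU0, hUp, hv, hlim⟩ := exists_ray_lift (G := G) hl ht₀
      fun t _ => G.openEdges_disjoint_base (G.mem_openEdges.2 ⟨j, t, rfl⟩)
    have hUe : ∀ t ≤ t₀, U t ∈ e := fun t ht => image_ray_subset he hU (fun t ht => by
      rw [mem_preimage, hUp t ht]; exact G.mem_openEdges.2 ⟨j, t, rfl⟩) (by rwa [hU0]) ht
    exact ⟨U, v, t₀, fun t ht => ⟨hUe t ht, hUp t ht⟩, hv,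
      closure_minimal (heF.trans frontier_subset_closure) isClosed_closure
        (mem_closure_of_ray hUe hlim), hlim⟩
  rintro e ⟨he, heF, heu⟩ e' ⟨he', heF', heu'⟩
  obtain ⟨U, v, t₀, hU, hv, hvF, hlim⟩ := key e he heF heu
  obtain ⟨U', v', t₀', hU', hv', hvF', hlim'⟩ := key e' he' heF' heu'
  obtain rfl : v = v' := hS.cross_unique hF hp hinj hv hv' hvF hvF'
  obtain ⟨W, hW, hWinj⟩ := isLocallyInjective_iff_nhds.1 hp.isLocallyInjective v
  obtain ⟨t, ⟨ht1, ht2⟩, ht3, ht4⟩ := (((hlim.eventually hW).and (hlim'.eventually hW)).and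
    ((Filter.eventually_le_atBot t₀).and (Filter.eventually_le_atBot t₀'))).exists
  have heq := hWinj ht1 ht2 ((hU t ht3).2.trans (hU' t ht4).2.symm)
  exact he.eq_of_mem_of_mem he' (hU t ht3).1 (heq ▸ (hU' t ht4).1)

end IsSector

end SymmetricBaseGraph

/-- The image of a component is connected, so it stays in one component of `T`. A face with a given
label is thus a component over a single face of the base graph. -/
theorem isComponentOf_preimage_iff {X Y : Type*} [TopologicalSpace X] [TopologicalSpace Y]
    {p : X → Y} (hp : Continuous p) {T : Set Y} {y : Y} {F : Set X} :
    IsComponentOf (p ⁻¹' T) F ∧ p '' F ⊆ connectedComponentIn T y ↔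
      IsComponentOf (p ⁻¹' connectedComponentIn T y) F := by
  constructor
  · rintro ⟨hF, hFy⟩
    obtain ⟨x, hx⟩ := hF.nonempty
    have hxy : x ∈ p ⁻¹' connectedComponentIn T y := hFy (mem_image_of_mem p hx)
    refine ⟨x, hxy, (hF.isPreconnected.subset_connectedComponentIn hx
      (image_subset_iff.1 hFy)).antisymm ?_⟩
    exact hF.subset_of_isPreconnected isPreconnected_connectedComponentIn
      ((connectedComponentIn_subset _ _).trans
        (preimage_mono (connectedComponentIn_subset _ _))) (mem_connectedComponentIn hxy) hx
  · rintro ⟨x, hx, rfl⟩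
    have hxT : x ∈ p ⁻¹' T := preimage_mono (connectedComponentIn_subset T y) hx
    have hsub : p '' connectedComponentIn (p ⁻¹' T) x ⊆ connectedComponentIn T y := by
      rw [connectedComponentIn_eq hx]
      exact (isPreconnected_connectedComponentIn.image p hp.continuousOn).subset_connectedComponentIn
        (mem_image_of_mem p (mem_connectedComponentIn hxT))
        (image_subset_iff.2 (connectedComponentIn_subset _ _))
    have heq : connectedComponentIn (p ⁻¹' connectedComponentIn T y) x =
        connectedComponentIn (p ⁻¹' T) x :=
      (connectedComponentIn_mono _ (preimage_mono (connectedComponentIn_subset _ _))).antisymm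
        (isPreconnected_connectedComponentIn.subset_connectedComponentIn
          (mem_connectedComponentIn hxT) (image_subset_iff.1 hsub))
    rw [heq]
    exact ⟨⟨x, hxT, rfl⟩, hsub⟩

/-! ### Symmetry, and the two implications for a real label -/

section Symmetric

variable {X : Type*} [TopologicalSpace X] [T2Space X] {p : X → Sphere}
  {B : Set Sphere} {G : SymmetricBaseGraph B} {b : Sphere} {s : X ≃ₜ X} {F : Set X}

omit [T2Space X] in
-- Conjugation preserves the base graph and fixes `b`, hence preserves the base face of `b`. Its
-- lift `s` permutes the components over that face.
theorem IsComponentOf.image_symm (hs : Function.Involutive s) (hsp : ∀ x, p (s x) = conj (p x))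
    (hb : conj b = b) (hbG : b ∈ G.graphᶜ)
    (hF : IsComponentOf (p ⁻¹' connectedComponentIn G.graphᶜ b) F) :
    IsComponentOf (p ⁻¹' connectedComponentIn G.graphᶜ b) (s '' F) := by
  have hΩ : conj '' connectedComponentIn G.graphᶜ b = connectedComponentIn G.graphᶜ b := by
    have h := conjHomeo.image_connectedComponentIn hbG
    rw [show ⇑conjHomeo = conj from rfl, image_compl_eq (show Function.Bijective conj from conjHomeo.bijective),
      G.image_conj_graph, hb] at h
    exact h
  have hpre : ∀ x ∈ p ⁻¹' connectedComponentIn G.graphᶜ b,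
      s x ∈ p ⁻¹' connectedComponentIn G.graphᶜ b := by
    intro x hx
    rw [mem_preimage, hsp, ← hΩ]
    exact mem_image_of_mem _ hx
  have : s '' (p ⁻¹' connectedComponentIn G.graphᶜ b) =
      p ⁻¹' connectedComponentIn G.graphᶜ b := by
    apply Subset.antisymm
    · rintro _ ⟨x, hx, rfl⟩
      exact hpre x hx
    · exact fun x hx => ⟨s x, hpre x hx, hs x⟩
  have h := hF.image_homeomorph s
  rwa [this] at h

namespace SymmetricBaseGraph

theorem base_subset_compl_graph (hb : b ∈ B) : b ∈ G.graphᶜ := by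
  obtain ⟨L, α, R, hS, rfl⟩ := G.exists_isSector hb
  have := hS.pt_axis_mem 0
  simp only [Complex.ofReal_zero, zero_add] at this
  exact connectedComponentIn_subset _ _ this

/-- If all preimages of `b` lie on the axis, then every vertex lies on the axis or on the boundary
of a face labeled by `b` with infinitely many vertices. -/
theorem fixed_or_exists_infinite_face (hp : IsLocalHomeomorph p) (hl : LocallySectioned p Bᶜ)
    (φ : ℂ ≃ₜ X) (hinf : (p ⁻¹' {G.cross, G.circ}).Infinite) (hs : Function.Involutive s)
    (hsp : ∀ x, p (s x) = conj (p x)) (hbB : b ∈ B) (hb : conj b = b)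
    (hfix : ∀ x, p x = b → s x = x) {v : X} (hv : p v = G.cross) :
    s v = v ∨ ∃ F, IsComponentOf (p ⁻¹' connectedComponentIn G.graphᶜ b) F ∧ v ∈ frontier F ∧
      ¬ (p ⁻¹' {G.cross} ∩ frontier F).Finite := by
  have hbG := base_subset_compl_graph (G := G) hbB
  obtain ⟨L, α, R, hS, rfl⟩ := G.exists_isSector hbB
  obtain ⟨F, hF, hvF⟩ := hS.exists_face hp hv
  by_cases hfin : (p ⁻¹' {G.cross} ∩ frontier F).Finite
  · left
    obtain ⟨x, hxF, hx⟩ := hS.exists_mem_center hF hp hl φ hinf hfin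
    have hsF := hF.image_symm hs hsp hb hbG
    have hFF : s '' F = F := hsF.eq_of_mem_of_mem hF (x := x) ⟨x, hxF, hfix x hx⟩ hxF
    -- As `×` is real, `s v` is again a vertex over `×`, and it lies on the boundary of `s '' F =
    -- F`.
    refine hS.cross_unique hF hp (hS.injOn_face hF hxF hx hp hl)
      (by rw [hsp, hv, G.conj_cross]) hv ?_ hvF
    rw [← hFF, ← s.image_closure]
    exact mem_image_of_mem s hvF
  · right
    refine ⟨F, hF, ⟨hvF, fun h => ?_⟩, hfin⟩
    have := hF.subset (interior_subset h)
    rw [mem_preimage, hv] at this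
    exact G.cross_notMem_component _ this

/-- A face that contains a preimage of its label is bounded. -/
theorem finite_boundary (hp : IsLocalHomeomorph p) (hl : LocallySectioned p Bᶜ) (hbB : b ∈ B)
    (hF : IsComponentOf (p ⁻¹' connectedComponentIn G.graphᶜ b) F) {x : X} (hxF : x ∈ F)
    (hx : p x = b) : {e | IsComponentOf (p ⁻¹' G.openEdges) e ∧ e ⊆ frontier F}.Finite ∧
      (p ⁻¹' {G.cross, G.circ} ∩ frontier F).Finite := by
  -- The lemmas on sectors only see the vertex `×`; the vertices over `∘` are handled by `flip`.
  have key : ∀ G : SymmetricBaseGraph B,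
      IsComponentOf (p ⁻¹' connectedComponentIn G.graphᶜ b) F →
      {e | IsComponentOf (p ⁻¹' G.openEdges) e ∧ e ⊆ frontier F}.Finite ∧
        (p ⁻¹' {G.cross} ∩ frontier F).Finite := by
    intro G hF
    obtain ⟨L, α, R, hS, rfl⟩ := G.exists_isSector hbB
    refine ⟨hS.finite_edges hF hxF hx hp hl, Subsingleton.finite ?_⟩
    rintro v ⟨hv, hvF⟩ v' ⟨hv', hvF'⟩
    exact hS.cross_unique hF hp (hS.injOn_face hF hxF hx hp hl) hv hv'
      (frontier_subset_closure hvF) (frontier_subset_closure hvF')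
  refine ⟨(key G hF).1, ?_⟩
  have h1 := (key G hF).2
  have h2 := (key G.flip (by rwa [G.flip_graph])).2
  rw [G.flip_cross] at h2
  refine (h1.union h2).subset ?_
  rintro v ⟨hv | hv, hvF⟩
  · exact Or.inl ⟨hv, hvF⟩
  · exact Or.inr ⟨hv, hvF⟩

/-- If every vertex lies on the axis or on the boundary of an unbounded face labeled by `b`, then all
preimages of `b` lie on the axis. -/
theorem fixed_of_forall_vertex (hp : IsLocalHomeomorph p) (hl : LocallySectioned p Bᶜ)
    (hs : Function.Involutive s) (hsp : ∀ x, p (s x) = conj (p x)) (hbB : b ∈ B) (hb : conj b = b)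
    (hvert : ∀ v, p v = G.cross → s v = v ∨
      ∃ F, IsComponentOf (p ⁻¹' connectedComponentIn G.graphᶜ b) F ∧ v ∈ frontier F ∧
      ¬ ({e | IsComponentOf (p ⁻¹' G.openEdges) e ∧ e ⊆ frontier F}.Finite ∧
        (p ⁻¹' {G.cross, G.circ} ∩ frontier F).Finite)) {x : X} (hx : p x = b) : s x = x := by
  have hbG := base_subset_compl_graph (G := G) hbB
  have hxΩ : x ∈ p ⁻¹' connectedComponentIn G.graphᶜ b := by
    rw [mem_preimage, hx]
    exact mem_connectedComponentIn hbG
  have hF := isComponentOf_connectedComponentIn hxΩ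
  have hxF := mem_connectedComponentIn hxΩ
  set F := connectedComponentIn (p ⁻¹' connectedComponentIn G.graphᶜ b) x
  have hfin := finite_boundary hp hl hbB hF hxF hx
  obtain ⟨L, α, R, hS, rfl⟩ := G.exists_isSector hbB
  obtain ⟨v, hvF, hv⟩ := hS.exists_cross hF hxF hx hp hl
  rcases hvert v hv with hsv | ⟨F', hF', hvF', hunb⟩
  · have hsF := hF.image_symm hs hsp hb hbG
    have hvs : v ∈ closure (s '' F) := by
      rw [← s.image_closure]
      exact ⟨v, frontier_subset_closure hvF, hsv⟩
    -- The fixed vertex `v` is in the closure of `F` and of `s '' F`, so these faces coincide.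
    have hFF := hS.face_unique hsF hp hF hv hvs (frontier_subset_closure hvF)
    refine hS.injOn_face hF hxF hx hp hl ?_ hxF (by rw [hsp, hx, hb])
    rw [← hFF]
    exact mem_image_of_mem s hxF
  · have hFF := hS.face_unique hF hp hF' hv (frontier_subset_closure hvF)
      (frontier_subset_closure hvF')
    exact absurd (hFF ▸ hfin) hunb

end SymmetricBaseGraph

end Symmetric

/-! ### Zeros of the associated function and the proof of the equivalence -/

/-- The zeros of a meromorphic function whose map to the sphere is continuous. -/
theorem toSphere_eq_zero_iff {f : ℂ → ℂ} (hf : MeromorphicOn f univ)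
    (hc : Continuous (toSphere f)) (z : ℂ) :
    toSphere f z = ((0 : ℂ) : Sphere) ↔ 0 < meromorphicOrderAt f z := by
  by_cases hneg : meromorphicOrderAt f z < 0
  · have h1 : toSphere f z = ∞ := by rw [toSphere, if_pos hneg]
    rw [h1]
    exact iff_of_false (OnePoint.infty_ne_coe _) (not_lt.2 hneg.le)
  · have h1 : toSphere f z = (f z : Sphere) := by rw [toSphere, if_neg hneg]
    have h2 : ∀ᶠ w in 𝓝 z, toSphere f w = (f w : Sphere) := by
      have : ∀ᶠ w in 𝓝 z, toSphere f w ≠ ∞ :=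
        hc.continuousAt.eventually_ne (by rw [h1]; exact OnePoint.coe_ne_infty _)
      filter_upwards [this] with w hw
      by_cases h : meromorphicOrderAt f w < 0
      · exact absurd (by rw [toSphere, if_pos h]) hw
      · rw [toSphere, if_neg h]
    -- A meromorphic `f` may take an arbitrary value at a removable singularity. Continuity of
    -- `toSphere f` rules this out, so that `f z = 0` agrees with the order being positive.
    have h3 : Filter.Tendsto f (𝓝 z) (𝓝 (f z)) := by
      rw [OnePoint.isOpenEmbedding_coe.isInducing.tendsto_nhds_iff]
      have := hc.tendsto z
      rw [h1] at this
      exact this.congr' h2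
    have h4 : Filter.Tendsto f (𝓝[≠] z) (𝓝 (f z)) := h3.mono_left nhdsWithin_le_nhds
    rw [h1, OnePoint.coe_injective.eq_iff,
      ← tendsto_zero_iff_meromorphicOrderAt_pos (hf z (mem_univ z))]
    constructor
    · intro h
      rwa [h] at h4
    · exact fun h => tendsto_nhds_unique h4 h

/-- A logarithmic end is traversed by an injective sequence of vertices. -/
theorem SymmetricSpeiserGraph.infinite_vertices {X : Type*} [TopologicalSpace X] {A : Set Sphere}
    {π : X → Sphere} {s : X → X} {D : DiscSystem A} (S : SymmetricSpeiserGraph π s D)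
    (h : S.logEnds.Nonempty) : S.vertices.Infinite := by
  obtain ⟨b, hb⟩ := h
  obtain ⟨u, hu, _⟩ := hb.prop
  have := Infinite.of_injective u hu
  exact infinite_coe_iff.1 this

end NSurface

end

end

theorem proposition3 {X : Type*} [TopologicalSpace X] (A : Set NSurface.Sphere)
    (π : X → NSurface.Sphere) (s : X → X) (hX : NSurface.IsSymmetricNSurface A π s)
    (D : NSurface.DiscSystem A) (S : NSurface.SymmetricSpeiserGraph π s D)
    (f : ℂ → ℂ) (hf : NSurface.IsAssociatedFunction π s f)
    (h_ends : 3 ≤ S.logEnds.encard)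
    (h_zero : ((0 : ℂ) : NSurface.Sphere) ∈ A)
    (h_real : {p ∈ NSurface.realLogSingularities π s D |
      p.1 ≠ ((0 : ℂ) : NSurface.Sphere)}.Subsingleton)
    (h_label : ((0 : ℂ) : NSurface.Sphere) ∉ S.deformation.moved) :
    (∀ z : ℂ, 0 < meromorphicOrderAt f z → z.im = 0) ↔
      ∀ v ∈ S.vertices, v ∈ NSurface.axis s ∨
        ∃ F, S.IsFace F ∧ ¬ S.IsBounded F ∧ S.HasLabel F ((0 : ℂ) : NSurface.Sphere) ∧
          v ∈ frontier F := by
  obtain ⟨hmer, φ, hφ, hπφ⟩ := hf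
  have : T2Space X := φ.symm.isEmbedding.t2Space
  have : LocallyConnectedSpace X := φ.symm.isOpenEmbedding.locallyConnectedSpace
  have hp := S.deformation.isLocalHomeomorph_map hX hφ
  have hne : S.logEnds.Nonempty := by
    rw [Set.nonempty_iff_ne_empty]
    intro h
    rw [h, Set.encard_empty] at h_ends
    exact absurd h_ends (by norm_num)
  have hinf : (S.deformation.map ⁻¹' {S.baseGraph.cross, S.baseGraph.circ}).Infinite :=
    S.infinite_vertices hne
  -- The two vertices of the base graph form a finite set with infinite preimage. This excludes
  -- finite coverings of a punctured disc whose puncture is not filled.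
  have hl := S.deformation.locallySectioned_map hX hφ
    (S.deformation.exists_infinite_preimage hX hφ (by simp) hinf)
  have hbB : ((0 : ℂ) : NSurface.Sphere) ∈ S.deformation.base := Or.inl ⟨h_zero, h_label⟩
  have hb : NSurface.conj ((0 : ℂ) : NSurface.Sphere) = ((0 : ℂ) : NSurface.Sphere) := by simp
  have hsp := S.deformation.map_involution hX hφ
  have hfix : (∀ z : ℂ, 0 < meromorphicOrderAt f z → z.im = 0) ↔
      ∀ x, S.deformation.map x = ((0 : ℂ) : NSurface.Sphere) → s x = x := by
    have hc : Continuous (NSurface.toSphere f) := by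
      rw [← show π ∘ φ = NSurface.toSphere f from funext hπφ]
      exact hX.isLocalHomeomorph.continuous.comp φ.continuous
    rw [φ.surjective.forall]
    refine forall_congr' fun z => ?_
    rw [S.deformation.map_eq_iff_of_notMem_moved hX hφ h_zero h_label, hπφ,
      NSurface.toSphere_eq_zero_iff hmer hc, ← NSurface.mem_axis_iff hφ]
    rfl
  have hface : ∀ F, S.IsFace F ∧ S.HasLabel F ((0 : ℂ) : NSurface.Sphere) ↔
      NSurface.IsComponentOf (S.deformation.map ⁻¹' connectedComponentIn S.baseGraph.graphᶜ
        ((0 : ℂ) : NSurface.Sphere)) F := by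
    intro F
    rw [← NSurface.isComponentOf_preimage_iff hp.continuous]
    exact and_congr_right fun _ => and_iff_right hbB
  rw [hfix]
  constructor
  · intro h v hv
    -- Allowing any base graph with the same underlying graph and pair of vertices lets the case of
    -- `∘` follow by applying this to `flip`.
    have key : ∀ G : NSurface.SymmetricBaseGraph S.deformation.base,
        G.graph = S.baseGraph.graph →
        ({G.cross, G.circ} : Set NSurface.Sphere) = {S.baseGraph.cross, S.baseGraph.circ} →
        S.deformation.map v = G.cross → v ∈ NSurface.axis s ∨
          ∃ F, S.IsFace F ∧ ¬ S.IsBounded F ∧ S.HasLabel F ((0 : ℂ) : NSurface.Sphere) ∧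
            v ∈ frontier F := by
      intro G hG hGv hvG
      rcases NSurface.SymmetricBaseGraph.fixed_or_exists_infinite_face (s := hX.involution) hp hl φ
        (by rwa [hGv]) hX.involutive hsp hbB hb h hvG with hsv | ⟨F, hF, hvF, hFinf⟩
      · exact Or.inl hsv
      · right
        rw [hG] at hF
        obtain ⟨h1, h2⟩ := (hface F).2 hF
        refine ⟨F, h1, fun hbd => hFinf (hbd.2.subset ?_), h2, hvF⟩
        refine Set.inter_subset_inter_left _ (Set.preimage_mono ?_)
        rw [← hGv]
        exact Set.singleton_subset_iff.2 (Or.inl rfl)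
    rcases hv with hv | hv
    · exact key S.baseGraph rfl rfl hv
    · refine key S.baseGraph.flip S.baseGraph.flip_graph ?_ (hv.trans S.baseGraph.flip_cross.symm)
      rw [S.baseGraph.flip_cross, S.baseGraph.flip_circ, Set.pair_comm]
  · intro h x hx
    refine NSurface.SymmetricBaseGraph.fixed_of_forall_vertex (G := S.baseGraph)
      (s := hX.involution) hp hl hX.involutive hsp hbB hb (fun v hv => ?_) hx
    -- For this direction the vertices over `×` suffice, because every face that contains a zero has
    -- one on its boundary.
    rcases h v (Or.inl hv) with hsv | ⟨F, h1, h2, h3, h4⟩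
    · exact Or.inl hsv
    · exact Or.inr ⟨F, (hface F).1 ⟨h1, h3⟩, h4, h2⟩
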